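/- Let $\mathbb{H}$ be the real algebra of quaternions, $\mathbb{S}=\{I\in\mathbb{H}: I^2=-1\}$, and for $I\in\mathbb{S}$ let $L_I=\mathbb{R}+I\mathbb{R}$. Let $\widehat{\mathbb{H}}=\mathbb{H}\cup\{\infty\}$ be the Alexandroff compactification of $\mathbb{H}$ and $\widehat{\mathbb{R}}=\mathbb{R}\cup\{\infty\}$. A real differentiable function $f$ on a domain $\Omega\subseteq\mathbb{H}$ is *regular* if $\frac12\left(\frac{\partial}{\partial x}+I\frac{\partial}{\partial y}\right)f(x+Iy)=0$ for all $I\in\mathbb{S}$ and all $x+Iy\in\Omega$. If $p\in L_I$ and $\Omega$ contains a punctured disc $\{z\in L_I: 0<|z-p|<R\}$, then $f(z)=\sum_{n\in\mathbb{Z}}(z-p)^na_n$ on it for some $a_n\in\mathbb{H}$; the singularity $p$ is *non-essential* if only finitely many $a_n$ with $n<0$ are nonzero, and it is a *pole* (of positive order) if moreover at least one of them is nonzero; for $p\in\mathbb{R}$ this is required for every $I\in\mathbb{S}$. The point $\infty$ is a pole of $f$ if $0$ is a pole of $q\mapsto f(q^{-1})$. A function $f$ is *semiregular in $\mathbb{H}$*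 if it is regular on a domain $\Omega\subseteq\mathbb{H}$ such that every point $p$ of $\mathbb{H}\setminus\Omega$ is a non-essential singularity of $f$ (in particular isolated within each $L_I\ni p$). For power series $f(q)=\sum_n q^na_n$ and $g(q)=\sum_n q^nb_n$ converging on $\mathbb{H}$, put $f*g(q)=\sum_n q^n\sum_{k=0}^n a_kb_{n-k}$, $f^c(q)=\sum_n q^n\bar a_n$, $f^s=f*f^c$, and, if $f\not\equiv 0$, $f^{-*}*g(q)=f^s(q)^{-1}\,(f^c*g)(q)$ wherever $f^s(q)\ne0$. For $A=\begin{pmatrix}a&c\\ b&d\end{pmatrix}\in GL(2,\mathbb{H})$, the *regular fractional transformation* associated to $A$ is $\mathcal{F}_A(q)=(qc+d)^{-*}*(qa+b)$, and the *linear fractional transformation* associated to $A$ is $F_A:\widehat{\mathbb{H}}\to\widehat{\mathbb{H}}$, $F_A(q)=(qc+d)^{-1}(qa+b)$, where $F_A(\infty)=\infty$ if $c=0$, and $F_A(-dc^{-1})=\infty$, $F_A(\infty)=c^{-1}a$ if $c\neq0$. Let $\mathcal{G}=\{\mathcal{F}_A: A\in GL(2,\mathbb{H})\}$ and $\mathbb{G}=\{F_A: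 A\in GL(2,\mathbb{H})\}$. A semiregular function $f$ is identified with $\mathcal{F}_A$ if the two agree wherever both are defined, and with $F_A$ if $F_A$ extends $f$. **Corollary.** Let $f$ be semiregular in $\mathbb{H}$. The following are equivalent: 1. $f$ extends to a homeomorphism from $\widehat{\mathbb{H}}$ onto itself; 2. $f$ extends to a continuous, injective map $\widehat{\mathbb{H}}\to\widehat{\mathbb{H}}$; 3. $f$ is a regular fractional transformation $\mathcal{F}_A$ having a pole in $\widehat{\mathbb{R}}$; 4. $f\in\mathcal{G}\cap\mathbb{G}$. -/

import Mathlib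

open scoped Quaternion

namespace SliceRegular

noncomputable section

/-- The sphere `𝕊` of quaternionic imaginary units. -/
def imagUnits : Set ℍ[ℝ] := {I | I ^ 2 = -1}

/-- The complex line `L_I = ℝ + Iℝ`. -/
def slice (I : ℍ[ℝ]) : Set ℍ[ℝ] := {q | ∃ x y : ℝ, q = (x : ℍ[ℝ]) + I * (y : ℍ[ℝ])}

/-- The operator `∂̄_I f (x + Iy) = ½ (∂/∂x + I ∂/∂y) f_I (x + Iy)`. -/
def dbar (I : ℍ[ℝ]) (f : ℍ[ℝ] → ℍ[ℝ]) (x y : ℝ) : ℍ[ℝ] :=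
  (1 / 2 : ℝ) •
    (deriv (fun s : ℝ => f ((s : ℍ[ℝ]) + I * (y : ℍ[ℝ]))) x +
      I * deriv (fun t : ℝ => f ((x : ℍ[ℝ]) + I * (t : ℍ[ℝ]))) y)

/-- `f` is regular on the domain `Ω`. Only the values of `f` on `Ω` matter. -/
structure IsRegularOn (Ω : Set ℍ[ℝ]) (f : ℍ[ℝ] → ℍ[ℝ]) : Prop where
  isOpen : IsOpen Ω
  isConnected : IsConnected Ω
  differentiable : DifferentiableOn ℝ f Ω
  dbar_eq_zero : ∀ I ∈ imagUnits, ∀ x y : ℝ,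
    (x : ℍ[ℝ]) + I * (y : ℍ[ℝ]) ∈ Ω → dbar I f x y = 0

/-- `Ω` contains the punctured disc of radius `R` about `p` in `L_I`, and on it
`f_I(z) = ∑_{n ∈ ℤ} (z - p)^n a_n`. -/
def HasLaurentExpansion (Ω : Set ℍ[ℝ]) (f : ℍ[ℝ] → ℍ[ℝ]) (I p : ℍ[ℝ]) (R : ℝ)
    (a : ℤ → ℍ[ℝ]) : Prop :=
  0 < R ∧ ∀ z ∈ slice I, z ≠ p → ‖z - p‖ < R →
    z ∈ Ω ∧ HasSum (fun n : ℤ => (z - p) ^ n * a n) (f z)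

/-- `p` is an isolated singularity of `f` in each complex line through `p`, and it is not
essential: the Laurent expansion at `p` has finite principal part (possibly zero, i.e. poles
of order `0` are allowed). -/
def IsNonessentialAt (Ω : Set ℍ[ℝ]) (f : ℍ[ℝ] → ℍ[ℝ]) (p : ℍ[ℝ]) : Prop :=
  ∀ I ∈ imagUnits, p ∈ slice I → ∃ (R : ℝ) (a : ℤ → ℍ[ℝ]) (N : ℕ),
    HasLaurentExpansion Ω f I p R a ∧ ∀ m : ℕ, N < m → a (-(m : ℤ)) = 0

/-- `p` is a pole of `f` of positive order: the Laurent expansion at `p` in each complex line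
through `p` has finite and nonzero principal part. -/
def HasPoleAt (Ω : Set ℍ[ℝ]) (f : ℍ[ℝ] → ℍ[ℝ]) (p : ℍ[ℝ]) : Prop :=
  ∀ I ∈ imagUnits, p ∈ slice I → ∃ (R : ℝ) (a : ℤ → ℍ[ℝ]) (N : ℕ),
    HasLaurentExpansion Ω f I p R a ∧ (∀ m : ℕ, N < m → a (-(m : ℤ)) = 0) ∧
      ∃ m : ℕ, 0 < m ∧ a (-(m : ℤ)) ≠ 0

/-- `∞` is a pole of `f`: the function `q ↦ f(q⁻¹)` has a pole at `0`. -/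
def HasPoleAtInfty (Ω : Set ℍ[ℝ]) (f : ℍ[ℝ] → ℍ[ℝ]) : Prop :=
  HasPoleAt {q | q ≠ 0 ∧ q⁻¹ ∈ Ω} (fun q => f q⁻¹) 0

/-- `f`, with domain of definition `Ω`, is semiregular in `ℍ`: it is regular on `Ω` and no
point of `ℍ` outside `Ω` is an essential singularity. -/
structure IsSemiregular (Ω : Set ℍ[ℝ]) (f : ℍ[ℝ] → ℍ[ℝ]) : Prop where
  isRegularOn : IsRegularOn Ω f
  nonessential : ∀ p, p ∉ Ω → IsNonessentialAt Ω f p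

/-- The value `∑ q^n a_n` of the series with coefficients `a_n`. The product of
`PowerSeries ℍ[ℝ]`, with coefficients `∑_{k ≤ n} a_k b_{n-k}`, is the regular product `*`. -/
def evalSeries (f : PowerSeries ℍ[ℝ]) (q : ℍ[ℝ]) : ℍ[ℝ] :=
  ∑' n : ℕ, q ^ n * PowerSeries.coeff n f

/-- The regular conjugate `f^c`. -/
def regConj (f : PowerSeries ℍ[ℝ]) : PowerSeries ℍ[ℝ] :=
  PowerSeries.mk fun n => star (PowerSeries.coeff n f)

/-- The symmetrization `f^s = f * f^c`. -/
def symmetrization (f : PowerSeries ℍ[ℝ]) : PowerSeries ℍ[ℝ] := f * regConj f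

/-- The domain of definition of the regular quotients with denominator `f`: the complement of
the zero set of `f^s`. -/
def regQuotDomain (f : PowerSeries ℍ[ℝ]) : Set ℍ[ℝ] :=
  {q | evalSeries (symmetrization f) q ≠ 0}

/-- The regular quotient `f^{-*} * g = (1 / f^s) (f^c * g)`, considered on `regQuotDomain f`. -/
def regQuot (f g : PowerSeries ℍ[ℝ]) (q : ℍ[ℝ]) : ℍ[ℝ] :=
  (evalSeries (symmetrization f) q)⁻¹ * evalSeries (regConj f * g) q

/-- The regular function `q ↦ q a + b`, as a power series. -/
def affineSeries (a b : ℍ[ℝ]) : PowerSeries ℍ[ℝ] :=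
  PowerSeries.X * PowerSeries.C a + PowerSeries.C b

/-- The group `GL(2, ℍ)`; its elements are written `(a c; b d)`, so that `a = A 0 0`,
`c = A 0 1`, `b = A 1 0`, `d = A 1 1`. -/
abbrev GL2H : Type := (Matrix (Fin 2) (Fin 2) ℍ[ℝ])ˣ

/-- The domain of definition of the regular fractional transformation of `A`. -/
def regFracDomain (A : GL2H) : Set ℍ[ℝ] :=
  regQuotDomain (affineSeries (A.val 0 1) (A.val 1 1))

/-- The regular fractional transformation `(qc+d)^{-*} * (qa+b)`. -/
def regFrac (A : GL2H) : ℍ[ℝ] → ℍ[ℝ] :=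
  regQuot (affineSeries (A.val 0 1) (A.val 1 1)) (affineSeries (A.val 0 0) (A.val 1 0))

open Classical in
/-- The linear fractional transformation `(qc+d)⁻¹(qa+b)` of `ℍ ∪ {∞}`. -/
def linFrac (A : GL2H) : OnePoint ℍ[ℝ] → OnePoint ℍ[ℝ]
  | none =>
      if A.val 0 1 = 0 then OnePoint.infty
      else (((A.val 0 1)⁻¹ * A.val 0 0 : ℍ[ℝ]) : OnePoint ℍ[ℝ])
  | some q =>
      if q * A.val 0 1 + A.val 1 1 = 0 then OnePoint.infty
      else (((q * A.val 0 1 + A.val 1 1)⁻¹ * (q * A.val 0 0 + A.val 1 0) : ℍ[ℝ]) :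
        OnePoint ℍ[ℝ])

/-- `φ : ℍ ∪ {∞} → ℍ ∪ {∞}` extends the function `f` with domain of definition `Ω`. -/
def Extends (Ω : Set ℍ[ℝ]) (f : ℍ[ℝ] → ℍ[ℝ]) (φ : OnePoint ℍ[ℝ] → OnePoint ℍ[ℝ]) : Prop :=
  ∀ q ∈ Ω, φ (q : OnePoint ℍ[ℝ]) = ((f q : ℍ[ℝ]) : OnePoint ℍ[ℝ])

/-- `f` (with domain of definition `Ω`) is the regular fractional transformation of `A`:
as usual for functions with poles and removable singularities, two of them are the same when
they agree wherever both are defined. -/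
def EqRegFrac (Ω : Set ℍ[ℝ]) (f : ℍ[ℝ] → ℍ[ℝ]) (A : GL2H) : Prop :=
  ∀ q ∈ Ω ∩ regFracDomain A, f q = regFrac A q

/-- `f` belongs to the set `𝒢` of regular fractional transformations. -/
def MemRegFrac (Ω : Set ℍ[ℝ]) (f : ℍ[ℝ] → ℍ[ℝ]) : Prop := ∃ A : GL2H, EqRegFrac Ω f A

/-- `f` belongs to the group `𝔾` of linear fractional transformations. -/
def MemLinFrac (Ω : Set ℍ[ℝ]) (f : ℍ[ℝ] → ℍ[ℝ]) : Prop := ∃ A : GL2H, Extends Ω f (linFrac A)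

/-- `f` is a regular fractional transformation with pole in `ℝ ∪ {∞}`. The pole is taken in the
natural domain of the transformation. -/
def IsRegFracWithRealPole (Ω : Set ℍ[ℝ]) (f : ℍ[ℝ] → ℍ[ℝ]) : Prop :=
  ∃ A : GL2H, EqRegFrac Ω f A ∧
    ((∃ x : ℝ, HasPoleAt (regFracDomain A) (regFrac A) (x : ℍ[ℝ])) ∨
      HasPoleAtInfty (regFracDomain A) (regFrac A))

end

end SliceRegular

/-! The main point is that a semiregular function with a continuous injective extension φ to ℍ ∪ {∞}
is either qa + b or (q - x)⁻¹a + b, with x real and a ≠ 0. Where φ is finite, its restriction to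
each L_I is holomorphic for left multiplication by I. So φ takes the value ∞ somewhere, since
otherwise Liouville's theorem makes it constant on L_i. It cannot do so at a nonreal point p of L_I:
the representation formula expresses φ on L_I through its values on L_J and L_{-J} with J ≠ ±I, and
these stay finite near p (`im_eq_zero_of_eq_infty`). If it does so at a real x, the substitution q ↦
x + q⁻¹ moves that point to ∞.

There remains an injective entire slice function g that tends to ∞ at ∞
(`exists_affine_of_injective`). For real x put h = g - g(x). The symmetrization h^s is an entire
function on L_i ≅ ℂ, with modulus ‖h(q)‖‖h(q')‖ for two points q, q' of the sphere of z. By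
injectivity it vanishes at most at x. It tends to ∞, so it is C(z - x)^M. On the real axis it equals
‖g(t) - g(x)‖². Varying x forces M = 2 and C independent of x, so g is a similarity on ℝ, hence
affine there, hence affine everywhere by the identity principle.

The rest is algebra. A pole at a real x forces d = -xc, a pole at ∞ forces c = 0. Scaling the matrix
on the left by c⁻¹ or d⁻¹ then turns the regular quotient into a pointwise one. Finally, `linFrac A`
is a homeomorphism with inverse `linFrac A⁻¹`. -/

namespace SliceRegular

open Filter Topology

noncomputable section

/-! ### Entire functions on ℂ with at most one zero -/

/-- An entire function without zeros outside `0` is a power of `z` times a nowhere vanishing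
entire function. -/
theorem exists_eq_pow_mul_of_ne_zero {r : ℂ → ℂ} (hr : Differentiable ℂ r)
    (h0 : ∀ z, z ≠ 0 → r z ≠ 0) :
    ∃ (M : ℕ) (ρ : ℂ → ℂ), Differentiable ℂ ρ ∧ (∀ z, ρ z ≠ 0) ∧ ∀ z, r z = z ^ M * ρ z := by
  have han : AnalyticAt ℂ r 0 := hr.analyticAt 0
  have hne : ¬ ∀ᶠ z in 𝓝 (0 : ℂ), r z = 0 := by
    intro h
    have h1 : ∀ᶠ z in 𝓝[≠] (0 : ℂ), r z = 0 := h.filter_mono nhdsWithin_le_nhds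
    obtain ⟨z, hz, hz'⟩ := (h1.and self_mem_nhdsWithin).exists
    exact h0 z hz' hz
  obtain ⟨M, g, hg, hg0, hrg⟩ := han.exists_eventuallyEq_pow_smul_nonzero_iff.mpr hne
  have hρ0 : (fun z => if z = 0 then g 0 else r z / z ^ M) =ᶠ[𝓝 0] g := by
    filter_upwards [hrg] with z hz
    split_ifs with h
    · rw [h]
    · rw [hz, sub_zero, smul_eq_mul, mul_div_cancel_left₀ _ (pow_ne_zero _ h)]
  refine ⟨M, fun z => if z = 0 then g 0 else r z / z ^ M, fun z => ?_, fun z => ?_, fun z => ?_⟩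
  · by_cases h : z = 0
    · rw [h]
      exact hg.differentiableAt.congr_of_eventuallyEq hρ0
    · have : (fun z => if z = 0 then g 0 else r z / z ^ M) =ᶠ[𝓝 z] fun z => r z / z ^ M := by
        filter_upwards [isOpen_ne.mem_nhds h] with w hw
        exact if_neg hw
      refine DifferentiableAt.congr_of_eventuallyEq ?_ this
      exact (hr z).div (by fun_prop) (pow_ne_zero _ h)
  · dsimp only
    split_ifs with h
    · exact hg0
    · exact div_ne_zero (h0 z h) (pow_ne_zero _ h)
  · dsimp only
    split_ifs with h
    · have := hrg.self_of_nhds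
      rw [h, this, sub_zero, smul_eq_mul]
    · field_simp

/-- An entire function that tends to infinity and vanishes at most at `x` is a multiple of a
power of `z - x`. -/
theorem exists_eq_const_mul_pow {s : ℂ → ℂ} (hs : Differentiable ℂ s) (x : ℂ)
    (hx : ∀ z, z ≠ x → s z ≠ 0) (hinf : Tendsto s (cocompact ℂ) (cocompact ℂ)) :
    ∃ (C : ℂ) (M : ℕ), C ≠ 0 ∧ ∀ z, s z = C * (z - x) ^ M := by
  have hshift : Tendsto (fun z : ℂ => x + z) (cocompact ℂ) (cocompact ℂ) :=
    (Homeomorph.addLeft x).isClosedEmbedding.tendsto_cocompact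
  obtain ⟨M, K, hK, hK0, hsK⟩ := exists_eq_pow_mul_of_ne_zero
    (r := fun z => s (x + z)) (hs.comp (by fun_prop)) (fun z hz => hx _ (by simpa using hz))
  -- The reciprocal of s in the coordinate w = 1/(z - x) at infinity. As s tends to ∞, the value 0
  -- at w = 0 removes the singularity.
  have hr : Differentiable ℂ (fun w : ℂ => if w = 0 then 0 else (s (x + w⁻¹))⁻¹) := by
    have hoff : ∀ w : ℂ, w ≠ 0 →
        DifferentiableAt ℂ (fun w : ℂ => if w = 0 then 0 else (s (x + w⁻¹))⁻¹) w := by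
      intro w hw
      have h1 : (fun w : ℂ => if w = 0 then 0 else (s (x + w⁻¹))⁻¹) =ᶠ[𝓝 w]
          fun w => (s (x + w⁻¹))⁻¹ := by
        filter_upwards [isOpen_ne.mem_nhds hw] with v hv
        exact if_neg hv
      refine DifferentiableAt.congr_of_eventuallyEq ?_ h1
      refine DifferentiableAt.inv ?_ (hx _ (by simpa using hw))
      exact (hs _).comp w ((differentiableAt_inv hw).const_add x)
    intro w
    by_cases hw : w = 0
    · subst hw
      refine (Complex.analyticAt_of_differentiable_on_punctured_nhds_of_continuousAt ?_
        ?_).differentiableAt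
      · filter_upwards [self_mem_nhdsWithin] with w hw using hoff w hw
      · rw [continuousAt_iff_punctured_nhds]
        have h1 : Tendsto (fun w : ℂ => (s (x + w⁻¹))⁻¹) (𝓝[≠] 0) (𝓝 0) := by
          refine Filter.tendsto_inv₀_cobounded.comp ?_
          rw [← Metric.cobounded_eq_cocompact] at hinf hshift
          exact hinf.comp (hshift.comp Filter.tendsto_inv₀_nhdsNE_zero)
        simp only [if_true]
        refine h1.congr' ?_
        filter_upwards [self_mem_nhdsWithin] with w hw
        exact (if_neg hw).symm
    · exact hoff w hw
  obtain ⟨N, ρ, hρ, hρ0, hrρ⟩ := exists_eq_pow_mul_of_ne_zero hr (fun w hw => by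
    simp only [if_neg hw]
    exact inv_ne_zero (hx _ (by simpa using hw)))
  -- The factorizations at x and at ∞ describe the same function. Depending on which of M, N is
  -- larger, K or 1/K has a finite limit at ∞, so K is constant by Liouville's theorem.
  have key : ∀ z : ℂ, z ≠ 0 → (z ^ M * K z)⁻¹ = (z⁻¹) ^ N * ρ z⁻¹ := by
    intro z hz
    have := hrρ z⁻¹
    rw [if_neg (inv_ne_zero hz), inv_inv] at this
    rw [← this, ← hsK]
  have hne : ∀ᶠ z in cocompact ℂ, z ≠ 0 := isCompact_singleton.compl_mem_cocompact
  have hinv : Tendsto (fun z : ℂ => z⁻¹) (cocompact ℂ) (𝓝 0) := by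
    rw [← Metric.cobounded_eq_cocompact]
    exact Filter.tendsto_inv₀_cobounded
  have hconst : ∃ C : ℂ, C ≠ 0 ∧ ∀ z, K z = C := by
    rcases le_total M N with h | h
    · have hl : Tendsto (fun z => (K z)⁻¹) (cocompact ℂ) (𝓝 ((0 : ℂ) ^ (N - M) * ρ 0)) := by
        have : Tendsto (fun z : ℂ => (z⁻¹) ^ (N - M) * ρ z⁻¹) (cocompact ℂ)
            (𝓝 ((0 : ℂ) ^ (N - M) * ρ 0)) :=
          (hinv.pow _).mul ((hρ.continuous.tendsto 0).comp hinv)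
        refine this.congr' ?_
        filter_upwards [hne] with z hz
        have h1 := key z hz
        have h2 : (z⁻¹ : ℂ) ^ N = z⁻¹ ^ (N - M) * z⁻¹ ^ M := by
          rw [← pow_add, Nat.sub_add_cancel h]
        rw [mul_inv, h2, ← inv_pow, mul_comm (z⁻¹ ^ (N - M)), mul_assoc] at h1
        exact (mul_left_cancel₀ (pow_ne_zero _ (inv_ne_zero hz)) h1).symm
      have hc : ∀ z, (K z)⁻¹ = (0 : ℂ) ^ (N - M) * ρ 0 := fun z =>
        (hK.inv hK0).apply_eq_of_tendsto_cocompact z hl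
      refine ⟨K 0, hK0 0, fun z => inv_injective ?_⟩
      rw [hc, hc]
    · have hl : Tendsto K (cocompact ℂ) (𝓝 ((0 : ℂ) ^ (M - N) * (ρ 0)⁻¹)) := by
        have : Tendsto (fun z : ℂ => (z⁻¹) ^ (M - N) * (ρ z⁻¹)⁻¹) (cocompact ℂ)
            (𝓝 ((0 : ℂ) ^ (M - N) * (ρ 0)⁻¹)) :=
          (hinv.pow _).mul (((hρ.continuous.tendsto 0).comp hinv).inv₀ (hρ0 0))
        refine this.congr' ?_
        filter_upwards [hne] with z hz
        have h1 := key z hz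
        have h2 : (z⁻¹ : ℂ) ^ M = z⁻¹ ^ (M - N) * z⁻¹ ^ N := by
          rw [← pow_add, Nat.sub_add_cancel h]
        rw [mul_inv, ← inv_pow, h2, mul_comm (z⁻¹ ^ (M - N)), mul_assoc] at h1
        have h3 := mul_left_cancel₀ (pow_ne_zero _ (inv_ne_zero hz)) h1
        rw [← h3, mul_inv, inv_inv, ← mul_assoc,
          mul_inv_cancel₀ (pow_ne_zero _ (inv_ne_zero hz)), one_mul]
      have hc : ∀ z, K z = (0 : ℂ) ^ (M - N) * (ρ 0)⁻¹ := fun z =>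
        hK.apply_eq_of_tendsto_cocompact z hl
      refine ⟨K 0, hK0 0, fun z => ?_⟩
      rw [hc, hc]
  obtain ⟨C, hC, hKC⟩ := hconst
  refine ⟨C, M, hC, fun z => ?_⟩
  have := hsK (z - x)
  rw [add_sub_cancel, hKC] at this
  rw [this, mul_comm]

/-! ### Slices as copies of ℂ, and holomorphy along them -/

/-- The embedding `x + iy ↦ x + Iy` of the complex numbers onto `L_I`. -/
def sliceEmb (I : ℍ[ℝ]) (z : ℂ) : ℍ[ℝ] := (z.re : ℍ[ℝ]) + I * (z.im : ℍ[ℝ])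

/-- The functional `u ↦ c(u) - i c(Iu)`, complex linear for the complex structure of left
multiplication by `I`. -/
def complexify (I : ℍ[ℝ]) (c : ℍ[ℝ] →L[ℝ] ℝ) : ℍ[ℝ] →L[ℝ] ℂ :=
  Complex.ofRealCLM.comp c -
    Complex.I • Complex.ofRealCLM.comp (c.comp (ContinuousLinearMap.mul ℝ ℍ[ℝ] I))

/-- `g : ℂ → ℍ` is holomorphic at `z` for the complex structure of left multiplication by `I`. -/
def HolomorphicAt (I : ℍ[ℝ]) (g : ℂ → ℍ[ℝ]) (z : ℂ) : Prop :=
  ∀ c : ℍ[ℝ] →L[ℝ] ℝ, DifferentiableAt ℂ (fun w => complexify I c (g w)) z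

theorem complexify_apply (I : ℍ[ℝ]) (c : ℍ[ℝ] →L[ℝ] ℝ) (u : ℍ[ℝ]) :
    complexify I c u = (c u : ℂ) - Complex.I * (c (I * u) : ℂ) := rfl

theorem imagUnits_mul_self {I : ℍ[ℝ]} (hI : I ∈ imagUnits) : I * I = -1 := by
  rw [← sq]; exact hI

theorem neg_mem_imagUnits {I : ℍ[ℝ]} (hI : I ∈ imagUnits) : -I ∈ imagUnits := by
  change (-I) ^ 2 = -1
  rw [neg_sq]; exact hI

theorem sliceEmb_eq (I : ℍ[ℝ]) (z : ℂ) : sliceEmb I z = (z.re : ℍ[ℝ]) + z.im • I := by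
  rw [sliceEmb, Quaternion.mul_coe_eq_smul]

@[simp] theorem sliceEmb_ofReal (I : ℍ[ℝ]) (t : ℝ) : sliceEmb I (t : ℂ) = (t : ℍ[ℝ]) := by
  simp [sliceEmb]

theorem sliceEmb_add (I : ℍ[ℝ]) (z w : ℂ) : sliceEmb I (z + w) = sliceEmb I z + sliceEmb I w := by
  simp only [sliceEmb_eq, Complex.add_re, Complex.add_im, Quaternion.coe_add, add_smul]
  abel

theorem sliceEmb_sub (I : ℍ[ℝ]) (z w : ℂ) : sliceEmb I (z - w) = sliceEmb I z - sliceEmb I w := by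
  simp only [sliceEmb_eq, Complex.sub_re, Complex.sub_im, Quaternion.coe_sub, sub_smul]
  abel

theorem sliceEmb_mul {I : ℍ[ℝ]} (hI : I ∈ imagUnits) (z w : ℂ) :
    sliceEmb I (z * w) = sliceEmb I z * sliceEmb I w := by
  have h := imagUnits_mul_self hI
  simp only [sliceEmb_eq, Complex.mul_re, Complex.mul_im, Quaternion.coe_sub,
    add_mul, mul_add, add_smul, Quaternion.coe_mul_eq_smul, Quaternion.mul_coe_eq_smul,
    smul_mul_smul_comm, h, smul_smul,
    smul_neg]
  simp only [← Quaternion.coe_one, Quaternion.smul_coe, mul_one]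
  rw [mul_comm w.re z.im, mul_comm w.re z.re]
  abel

theorem re_imagUnit {I : ℍ[ℝ]} (hI : I ∈ imagUnits) : I.re = 0 := by
  have h := imagUnits_mul_self hI
  have h0 := congrArg QuaternionAlgebra.re h
  have h1 := congrArg QuaternionAlgebra.imI h
  have h2 := congrArg QuaternionAlgebra.imJ h
  have h3 := congrArg QuaternionAlgebra.imK h
  simp at h0 h1 h2 h3
  by_contra hne
  have e1 : I.imI = 0 := by
    have : I.re * I.imI = 0 := by linarith
    exact (mul_eq_zero.mp this).resolve_left hne
  have e2 : I.imJ = 0 := by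
    have : I.re * I.imJ = 0 := by linarith
    exact (mul_eq_zero.mp this).resolve_left hne
  have e3 : I.imK = 0 := by
    have : I.re * I.imK = 0 := by linarith
    exact (mul_eq_zero.mp this).resolve_left hne
  rw [e1, e2, e3] at h0
  nlinarith [mul_self_nonneg I.re]

theorem norm_imagUnit {I : ℍ[ℝ]} (hI : I ∈ imagUnits) : ‖I‖ = 1 := by
  have h := congrArg norm (imagUnits_mul_self hI)
  rw [norm_mul, norm_neg, norm_one] at h
  nlinarith [norm_nonneg I]

theorem normSq_imagUnit {I : ℍ[ℝ]} (hI : I ∈ imagUnits) :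
    I.imI ^ 2 + I.imJ ^ 2 + I.imK ^ 2 = 1 := by
  have h0 := congrArg QuaternionAlgebra.re (imagUnits_mul_self hI)
  simp [re_imagUnit hI] at h0
  linarith

theorem norm_sliceEmb {I : ℍ[ℝ]} (hI : I ∈ imagUnits) (z : ℂ) : ‖sliceEmb I z‖ = ‖z‖ := by
  have h1 : ‖sliceEmb I z‖ * ‖sliceEmb I z‖ = ‖z‖ * ‖z‖ := by
    rw [← Quaternion.normSq_eq_norm_mul_self, Quaternion.normSq_def', ← sq ‖z‖, Complex.sq_norm,
      Complex.normSq_apply]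
    have := normSq_imagUnit hI
    simp [sliceEmb_eq, re_imagUnit hI]
    linear_combination z.im ^ 2 * this
  exact (mul_self_inj (norm_nonneg _) (norm_nonneg _)).mp h1

theorem sliceEmb_injective {I : ℍ[ℝ]} (hI : I ∈ imagUnits) :
    Function.Injective (sliceEmb I) := by
  intro z w h
  rw [← sub_eq_zero, ← norm_eq_zero, ← norm_sliceEmb hI, sliceEmb_sub, h, sub_self, norm_zero]

theorem continuous_sliceEmb (I : ℍ[ℝ]) : Continuous (sliceEmb I) := by
  have : Continuous (fun r : ℝ => (r : ℍ[ℝ])) := Quaternion.continuous_coe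
  unfold sliceEmb
  fun_prop

theorem sliceEmb_inv {I : ℍ[ℝ]} (hI : I ∈ imagUnits) (z : ℂ) :
    sliceEmb I z⁻¹ = (sliceEmb I z)⁻¹ := by
  by_cases hz : z = 0
  · have : sliceEmb I 0 = 0 := by simp [sliceEmb]
    simp [hz, this]
  · refine eq_inv_of_mul_eq_one_left ?_
    rw [← sliceEmb_mul hI, inv_mul_cancel₀ hz]
    simp [sliceEmb]

theorem mem_slice_iff {I q : ℍ[ℝ]} : q ∈ slice I ↔ ∃ z, sliceEmb I z = q :=
  ⟨fun ⟨x, y, h⟩ => ⟨⟨x, y⟩, h.symm⟩, fun ⟨z, h⟩ => ⟨z.re, z.im, h.symm⟩⟩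

/-- The imaginary unit `i`. -/
def unitI : ℍ[ℝ] := ⟨0, 1, 0, 0⟩

/-- The imaginary unit `j`. -/
def unitJ : ℍ[ℝ] := ⟨0, 0, 1, 0⟩

@[simp] theorem re_unitI : unitI.re = 0 := rfl
@[simp] theorem imI_unitI : unitI.imI = 1 := rfl
@[simp] theorem imJ_unitI : unitI.imJ = 0 := rfl
@[simp] theorem imK_unitI : unitI.imK = 0 := rfl
@[simp] theorem re_unitJ : unitJ.re = 0 := rfl
@[simp] theorem imI_unitJ : unitJ.imI = 0 := rfl
@[simp] theorem imJ_unitJ : unitJ.imJ = 1 := rfl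
@[simp] theorem imK_unitJ : unitJ.imK = 0 := rfl

theorem unitI_mem : unitI ∈ imagUnits := by
  change unitI ^ 2 = -1
  rw [sq]; ext <;> simp

theorem unitJ_mem : unitJ ∈ imagUnits := by
  change unitJ ^ 2 = -1
  rw [sq]; ext <;> simp

theorem exists_sliceEmb (q : ℍ[ℝ]) : ∃ I ∈ imagUnits, ∃ z, sliceEmb I z = q := by
  by_cases h : q.im = 0
  · refine ⟨unitI, unitI_mem, (q.re : ℂ), ?_⟩
    rw [sliceEmb_ofReal]
    conv_rhs => rw [← Quaternion.re_add_im q, h, add_zero]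
  · have hn : ‖q.im‖ ≠ 0 := norm_ne_zero_iff.mpr h
    refine ⟨‖q.im‖⁻¹ • q.im, ?_, ⟨q.re, ‖q.im‖⟩, ?_⟩
    · change _ = _
      have h1 : q.im * q.im = -((‖q.im‖ * ‖q.im‖ : ℝ) : ℍ[ℝ]) := by
        rw [← Quaternion.normSq_eq_norm_mul_self, ← Quaternion.self_mul_star, Quaternion.star_im]
        simp
      rw [sq, smul_mul_smul_comm, h1, smul_neg, Quaternion.smul_coe]
      congr 1
      rw [← Quaternion.coe_one]
      congr 1
      field_simp
    · rw [sliceEmb_eq, smul_smul, mul_inv_cancel₀ hn, one_smul, Quaternion.re_add_im]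

theorem complexify_sliceEmb_mul {I : ℍ[ℝ]} (hI : I ∈ imagUnits) (c : ℍ[ℝ] →L[ℝ] ℝ) (z : ℂ)
    (u : ℍ[ℝ]) : complexify I c (sliceEmb I z * u) = z * complexify I c u := by
  have h : I * (I * u) = -u := by rw [← mul_assoc, imagUnits_mul_self hI, neg_one_mul]
  simp only [complexify_apply, sliceEmb_eq, add_mul, Quaternion.coe_mul_eq_smul,
    smul_mul_assoc, map_add, map_smul, h, map_neg]
  apply Complex.ext <;> simp

/-- The real part of `complexify I c u` is `c u`, and real functionals separate points. This
transfers one-variable complex analysis to ℍ-valued functions, one functional at a time. -/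
theorem eq_zero_of_complexify {I u : ℍ[ℝ]} (h : ∀ c, complexify I c u = 0) : u = 0 := by
  refine SeparatingDual.eq_zero_of_forall_dual_eq_zero (R := ℝ) fun c => ?_
  have := congrArg Complex.re (h c)
  simpa [complexify_apply] using this

theorem eq_of_complexify {I u v : ℍ[ℝ]} (h : ∀ c, complexify I c u = complexify I c v) :
    u = v := by
  rw [← sub_eq_zero]
  exact eq_zero_of_complexify (I := I) fun c => by rw [map_sub, h, sub_self]

theorem HolomorphicAt.sub {I : ℍ[ℝ]} {g h : ℂ → ℍ[ℝ]} {z : ℂ} (hg : HolomorphicAt I g z)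
    (hh : HolomorphicAt I h z) : HolomorphicAt I (fun w => g w - h w) z := fun c => by
  simpa only [map_sub] using (hg c).fun_sub (hh c)

theorem HolomorphicAt.add {I : ℍ[ℝ]} {g h : ℂ → ℍ[ℝ]} {z : ℂ} (hg : HolomorphicAt I g z)
    (hh : HolomorphicAt I h z) : HolomorphicAt I (fun w => g w + h w) z := fun c => by
  simpa only [map_add] using (hg c).fun_add (hh c)

theorem holomorphicAt_const (I u : ℍ[ℝ]) (z : ℂ) : HolomorphicAt I (fun _ => u) z :=
  fun _ => differentiableAt_const _

theorem holomorphicAt_sliceEmb_mul {I : ℍ[ℝ]} (hI : I ∈ imagUnits) (u : ℍ[ℝ]) (z : ℂ) :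
    HolomorphicAt I (fun w => sliceEmb I w * u) z := fun c => by
  simp only [complexify_sliceEmb_mul hI]
  fun_prop

theorem HolomorphicAt.comp {I : ℍ[ℝ]} {g : ℂ → ℍ[ℝ]} {h : ℂ → ℂ} {z : ℂ}
    (hg : HolomorphicAt I g (h z)) (hh : DifferentiableAt ℂ h z) :
    HolomorphicAt I (fun w => g (h w)) z := fun c => (hg c).comp z hh

theorem HolomorphicAt.congr {I : ℍ[ℝ]} {g h : ℂ → ℍ[ℝ]} {z : ℂ} (hg : HolomorphicAt I g z)
    (hgh : h =ᶠ[𝓝 z] g) : HolomorphicAt I h z := fun c =>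
  (hg c).congr_of_eventuallyEq (hgh.fun_comp (complexify I c))

/-- Left multiplication by an element intertwining two complex structures preserves
holomorphy. -/
theorem HolomorphicAt.const_mul {I J T : ℍ[ℝ]} (hT : I * T = T * J) {g : ℂ → ℍ[ℝ]} {z : ℂ}
    (hg : HolomorphicAt J g z) : HolomorphicAt I (fun w => T * g w) z := fun c => by
  have := hg (c.comp (ContinuousLinearMap.mul ℝ ℍ[ℝ] T))
  simpa only [complexify_apply, ← mul_assoc, hT, ContinuousLinearMap.comp_apply,
    ContinuousLinearMap.mul_apply'] using this

/-! ### Removable singularities, identity principle, Liouville's theorem, representation formula -/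

theorem holomorphicAt_of_punctured {I : ℍ[ℝ]} {g : ℂ → ℍ[ℝ]} {z : ℂ}
    (hg : ∀ᶠ w in 𝓝[≠] z, HolomorphicAt I g w) (hc : ContinuousAt g z) :
    HolomorphicAt I g z := fun c =>
  (Complex.analyticAt_of_differentiable_on_punctured_nhds_of_continuousAt
    (hg.mono fun _ hw => hw c)
    ((complexify I c).continuous.continuousAt.comp hc)).differentiableAt

/-- Real points of U accumulate at t₀, so the identity theorem applies to each complex-valued
component. -/
theorem eq_zero_of_eq_zero_on_reals {I : ℍ[ℝ]} {g : ℂ → ℍ[ℝ]} {U : Set ℂ} (hU : IsOpen U)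
    (hUc : IsPreconnected U) (hg : ∀ z ∈ U, HolomorphicAt I g z) {t₀ : ℝ} (ht₀ : (t₀ : ℂ) ∈ U)
    (h0 : ∀ t : ℝ, (t : ℂ) ∈ U → g t = 0) {z : ℂ} (hz : z ∈ U) : g z = 0 := by
  refine eq_zero_of_complexify (I := I) fun c => ?_
  have han : AnalyticOnNhd ℂ (fun w => complexify I c (g w)) U :=
    DifferentiableOn.analyticOnNhd (fun w hw => (hg w hw c).differentiableWithinAt) hU
  refine han.eqOn_zero_of_preconnected_of_frequently_eq_zero hUc ht₀ ?_ hz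
  have h1 : Tendsto (fun t : ℝ => (t : ℂ)) (𝓝[≠] t₀) (𝓝[≠] (t₀ : ℂ)) :=
    Complex.continuous_ofReal.continuousAt.tendsto.inf
      (tendsto_principal_principal.mpr fun t ht => by simpa using ht)
  refine h1.frequently (Eventually.frequently ?_)
  have h2 : ∀ᶠ t : ℝ in 𝓝 t₀, (t : ℂ) ∈ U :=
    Complex.continuous_ofReal.continuousAt.eventually (hU.mem_nhds ht₀)
  filter_upwards [h2.filter_mono nhdsWithin_le_nhds] with t ht
  rw [h0 t ht, map_zero]

/-- Liouville's theorem for slice functions. -/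
theorem eq_of_tendsto_cocompact {I : ℍ[ℝ]} {g : ℂ → ℍ[ℝ]} (hg : ∀ z, HolomorphicAt I g z)
    {v : ℍ[ℝ]} (hv : Tendsto g (cocompact ℂ) (𝓝 v)) (z : ℂ) : g z = v :=
  eq_of_complexify (I := I) fun c =>
    Differentiable.apply_eq_of_tendsto_cocompact (fun w => hg w c) z
      (((complexify I c).continuous.tendsto v).comp hv)

/-- The representation formula: the values on `L_I` are determined by those on `L_J`. -/
theorem representation {F : ℍ[ℝ] → ℍ[ℝ]} {I J : ℍ[ℝ]} (hI : I ∈ imagUnits) (hJ : J ∈ imagUnits)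
    {U : Set ℂ} (hU : IsOpen U) (hUc : IsPreconnected U) {t₀ : ℝ} (ht₀ : (t₀ : ℂ) ∈ U)
    (hFI : ∀ z ∈ U, HolomorphicAt I (fun w => F (sliceEmb I w)) z)
    (hFJ : ∀ z ∈ U, HolomorphicAt J (fun w => F (sliceEmb J w)) z)
    (hFJ' : ∀ z ∈ U, HolomorphicAt (-J) (fun w => F (sliceEmb (-J) w)) z) {z : ℂ} (hz : z ∈ U) :
    F (sliceEmb I z) = ((1 / 2 : ℝ) • (1 - I * J)) * F (sliceEmb J z) +
      ((1 / 2 : ℝ) • (1 + I * J)) * F (sliceEmb (-J) z) := by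
  have hII := imagUnits_mul_self hI
  have hJJ := imagUnits_mul_self hJ
  rw [← sub_eq_zero]
  refine eq_zero_of_eq_zero_on_reals (I := I)
    (g := fun z => F (sliceEmb I z) - (((1 / 2 : ℝ) • (1 - I * J)) * F (sliceEmb J z) +
      ((1 / 2 : ℝ) • (1 + I * J)) * F (sliceEmb (-J) z))) hU hUc (fun w hw => ?_) ht₀
    (fun t _ => ?_) hz
  -- The coefficients intertwine the complex structures: I(1 - IJ) = (1 - IJ)J and I(1 + IJ) = (1 +
  -- IJ)(-J). Hence both sides are holomorphic for I. On the reals they agree, as the coefficients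
  -- add up to 1.
  · refine (hFI w hw).sub (((hFJ w hw).const_mul ?_).add ((hFJ' w hw).const_mul ?_))
    · rw [mul_smul_comm, smul_mul_assoc, mul_sub, sub_mul, ← mul_assoc, hII, mul_assoc I J J, hJJ]
      congr 1
      noncomm_ring
    · rw [mul_smul_comm, smul_mul_assoc, mul_add, add_mul, ← mul_assoc, hII, mul_neg, mul_neg,
        mul_assoc I J J, hJJ]
      congr 1
      noncomm_ring
  · simp only [sliceEmb_ofReal]
    rw [← add_mul, ← smul_add, sub_add_add_cancel, ← two_smul ℝ (1 : ℍ[ℝ]), smul_smul]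
    norm_num

/-- For the real differential L of f, the equation `dbar I f = 0` reads L(I) = I L(1). This is the
Cauchy–Riemann equation along L_I. -/
theorem IsRegularOn.holomorphicAt {Ω : Set ℍ[ℝ]} {f : ℍ[ℝ] → ℍ[ℝ]} (hf : IsRegularOn Ω f)
    {I : ℍ[ℝ]} (hI : I ∈ imagUnits) {z : ℂ} (hz : sliceEmb I z ∈ Ω) :
    HolomorphicAt I (fun w => f (sliceEmb I w)) z := by
  let σ : ℂ →L[ℝ] ℍ[ℝ] := Complex.reCLM.smulRight (1 : ℍ[ℝ]) + Complex.imCLM.smulRight I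
  have hσ : ∀ w, sliceEmb I w = σ w := fun w => by
    rw [sliceEmb_eq]
    simp only [σ, add_apply, ContinuousLinearMap.smulRight_apply,
      Complex.reCLM_apply, Complex.imCLM_apply, ← Quaternion.coe_mul_eq_smul, mul_one]
  have hfd : HasFDerivAt f (fderiv ℝ f (σ z)) (σ z) := by
    rw [hσ] at hz
    exact (hf.differentiable.differentiableAt (hf.isOpen.mem_nhds hz)).hasFDerivAt
  set L := fderiv ℝ f (σ z) with hL
  have h1 : σ 1 = 1 := by simp [σ]
  have hi : σ Complex.I = I := by simp [σ]
  have hCR : L I = I * L 1 := by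
    have hd := hf.dbar_eq_zero I hI z.re z.im hz
    have e1 : HasDerivAt (fun s : ℝ => f ((s : ℍ[ℝ]) + I * (z.im : ℍ[ℝ]))) (L 1) z.re := by
      have hin : HasDerivAt (fun s : ℝ => σ (s + z.im * Complex.I)) (σ 1) z.re :=
        σ.hasFDerivAt.comp_hasDerivAt z.re
          ((Complex.ofRealCLM.hasDerivAt (x := z.re)).add_const _)
      have hfd' : HasFDerivAt f L (σ (z.re + z.im * Complex.I)) := by
        rw [Complex.re_add_im]; exact hfd
      have := hfd'.comp_hasDerivAt z.re hin
      rw [h1] at this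
      refine this.congr_of_eventuallyEq (Eventually.of_forall fun s => ?_)
      simp [← hσ, sliceEmb]
    have e2 : HasDerivAt (fun t : ℝ => f ((z.re : ℍ[ℝ]) + I * (t : ℍ[ℝ]))) (L I) z.im := by
      have hin : HasDerivAt (fun t : ℝ => σ (z.re + t * Complex.I)) (σ Complex.I) z.im := by
        have := ((Complex.ofRealCLM.hasDerivAt (x := z.im)).mul_const Complex.I).const_add
          (z.re : ℂ)
        simp only [Complex.ofRealCLM_apply, Complex.ofReal_one, one_mul] at this
        exact σ.hasFDerivAt.comp_hasDerivAt z.im this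
      have hfd' : HasFDerivAt f L (σ (z.re + z.im * Complex.I)) := by
        rw [Complex.re_add_im]; exact hfd
      have := hfd'.comp_hasDerivAt z.im hin
      rw [hi] at this
      refine this.congr_of_eventuallyEq (Eventually.of_forall fun s => ?_)
      simp [← hσ, sliceEmb]
    rw [dbar, e1.deriv, e2.deriv, smul_eq_zero] at hd
    have hd' := hd.resolve_left (by norm_num)
    have := congrArg (I * ·) hd'
    simp only [mul_add, mul_zero, ← mul_assoc, imagUnits_mul_self hI, neg_one_mul] at this
    exact (sub_eq_zero.mp (by rw [sub_eq_add_neg]; exact this)).symm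
  intro c
  have hcomp : HasFDerivAt (fun w => complexify I c (f (sliceEmb I w)))
      ((complexify I c).comp (L.comp σ)) z := by
    simp only [hσ]
    exact (complexify I c).hasFDerivAt.comp z (hfd.comp z σ.hasFDerivAt)
  rw [differentiableAt_complex_iff_differentiableAt_real]
  refine ⟨hcomp.differentiableAt, ?_⟩
  rw [hcomp.fderiv]
  simp only [ContinuousLinearMap.comp_apply, h1, hi, hCR]
  have := complexify_sliceEmb_mul hI c Complex.I (L 1)
  simpa [sliceEmb] using this

/-! ### The Hermitian form and the symmetrization -/

/-- The real part, as a functional. -/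
def reFunctional : ℍ[ℝ] →L[ℝ] ℝ :=
  ⟨{ toFun := fun q => q.re, map_add' := fun _ _ => rfl, map_smul' := fun _ _ => rfl },
    Quaternion.continuous_re⟩

/-- The coefficient of `j`, as a functional. -/
def imJFunctional : ℍ[ℝ] →L[ℝ] ℝ :=
  ⟨{ toFun := fun q => q.imJ, map_add' := fun _ _ => rfl, map_smul' := fun _ _ => rfl },
    Quaternion.continuous_imJ⟩

@[simp] theorem reFunctional_apply (q : ℍ[ℝ]) : reFunctional q = q.re := rfl

@[simp] theorem imJFunctional_apply (q : ℍ[ℝ]) : imJFunctional q = q.imJ := rfl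

/-- The Hermitian form of `ℍ = ℂ ⊕ ℂ j`. -/
def hermitianForm (u v : ℍ[ℝ]) : ℂ :=
  complexify unitI reFunctional u * (starRingEnd ℂ) (complexify unitI reFunctional v) +
    complexify unitI imJFunctional u * (starRingEnd ℂ) (complexify unitI imJFunctional v)

/-- Put w = α + Iβ. The complex number, placed in L_I, is wᾱ + Iwβ̄ = w(ᾱ + I₁β̄) with I₁ = w⁻¹Iw.
The second factor has the norm of its conjugate α - βI₁, which is α + I'β for I' = -βI₁β⁻¹. -/
theorem exists_norm_mul_norm_eq {I : ℍ[ℝ]} (hI : I ∈ imagUnits) (α β : ℍ[ℝ]) :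
    ∃ I' ∈ imagUnits,
      ‖(⟨Quaternion.normSq α - Quaternion.normSq β, 2 * (α * star β).re⟩ : ℂ)‖ =
        ‖α + I * β‖ * ‖α + I' * β‖ := by
  set s : ℂ := ⟨Quaternion.normSq α - Quaternion.normSq β, 2 * (α * star β).re⟩ with hs
  have hII := imagUnits_mul_self hI
  have hemb : sliceEmb I s = (α + I * β) * star α + I * (α + I * β) * star β := by
    have h1 : ((2 * (α * star β).re : ℝ) : ℍ[ℝ]) = α * star β + β * star α := by
      have := Quaternion.self_add_star' (α * star β)
      rw [star_mul, star_star] at this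
      exact this.symm
    rw [sliceEmb]
    change ((Quaternion.normSq α - Quaternion.normSq β : ℝ) : ℍ[ℝ]) +
      I * ((2 * (α * star β).re : ℝ) : ℍ[ℝ]) = _
    rw [h1, Quaternion.coe_sub, ← Quaternion.self_mul_star, ← Quaternion.self_mul_star, mul_add I α,
      ← mul_assoc I I, hII]
    noncomm_ring
  rw [← norm_sliceEmb hI, hemb]
  by_cases hw : α + I * β = 0
  · refine ⟨I, hI, ?_⟩
    rw [hw]; simp
  set w := α + I * β with hwdef
  set I₁ := w⁻¹ * I * w with hI₁
  have hI₁I₁ : I₁ * I₁ = -1 := by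
    rw [hI₁]
    calc w⁻¹ * I * w * (w⁻¹ * I * w) = w⁻¹ * I * (w * w⁻¹) * I * w := by noncomm_ring
      _ = w⁻¹ * (I * I) * w := by rw [mul_inv_cancel₀ hw]; noncomm_ring
      _ = -1 := by rw [hII, mul_neg, mul_one, neg_mul, inv_mul_cancel₀ hw]
  have hfac : w * star α + I * w * star β = w * (star α + I₁ * star β) := by
    have : w * I₁ = I * w := by
      rw [hI₁, ← mul_assoc, ← mul_assoc, mul_inv_cancel₀ hw, one_mul]
    rw [mul_add w (star α), ← mul_assoc, this]
  have hI₁s : star I₁ = -I₁ := by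
    have : I₁.re = 0 := re_imagUnit (by change I₁ ^ 2 = -1; rw [sq, hI₁I₁])
    ext <;> simp [this]
  have hnorm : ‖star α + I₁ * star β‖ = ‖α - β * I₁‖ := by
    rw [← norm_star, star_add, star_star, star_mul, star_star, hI₁s, mul_neg, sub_eq_add_neg]
  rw [hfac, norm_mul, hnorm]
  by_cases hβ : β = 0
  · refine ⟨I, hI, ?_⟩
    simp [hβ]
  · refine ⟨-(β * I₁ * β⁻¹), ?_, ?_⟩
    · change _ ^ 2 = _
      rw [neg_sq, sq]
      calc β * I₁ * β⁻¹ * (β * I₁ * β⁻¹) = β * I₁ * (β⁻¹ * β) * I₁ * β⁻¹ := by noncomm_ring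
        _ = β * (I₁ * I₁) * β⁻¹ := by rw [inv_mul_cancel₀ hβ]; noncomm_ring
        _ = -1 := by rw [hI₁I₁, mul_neg, mul_one, neg_mul, mul_inv_cancel₀ hβ]
    · rw [neg_mul, mul_assoc (β * I₁), inv_mul_cancel₀ hβ, mul_one, sub_eq_add_neg]

/-- If u, v are the values of a slice function at z and its conjugate in L_i, the two quaternions on
the right are the α, β for which it takes the value α + Iβ on the sphere of z. -/
theorem hermitianForm_eq (u v : ℍ[ℝ]) :
    hermitianForm u v =
      ⟨Quaternion.normSq ((1 / 2 : ℝ) • (u + v)) -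
          Quaternion.normSq ((1 / 2 : ℝ) • (-(unitI * (u - v)))),
        2 * (((1 / 2 : ℝ) • (u + v)) * star ((1 / 2 : ℝ) • (-(unitI * (u - v))))).re⟩ := by
  apply Complex.ext
  · simp [hermitianForm, complexify_apply, Quaternion.normSq_def']
    ring
  · simp [hermitianForm, complexify_apply]
    ring

theorem hermitianForm_self (u : ℍ[ℝ]) : hermitianForm u u = ((‖u‖ ^ 2 : ℝ) : ℂ) := by
  rw [sq, ← Quaternion.normSq_eq_norm_mul_self, Quaternion.normSq_def']
  apply Complex.ext
  · rw [Complex.ofReal_re]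
    simp [hermitianForm, complexify_apply]
    ring
  · rw [Complex.ofReal_im]
    simp [hermitianForm, complexify_apply]
    ring

theorem sliceEmb_neg_eq_conj (I : ℍ[ℝ]) (z : ℂ) :
    sliceEmb (-I) z = sliceEmb I ((starRingEnd ℂ) z) := by
  simp [sliceEmb]

/-- For an entire slice function `h`, the function `h^s` (here computed on `L_i`) has modulus
`‖h q‖ ‖h q'‖` for two points of the sphere `x + y𝕊`, one of which is arbitrary. -/
theorem exists_norm_hermitianForm_eq {h : ℍ[ℝ] → ℍ[ℝ]}
    (hh : ∀ I ∈ imagUnits, ∀ z, HolomorphicAt I (fun w => h (sliceEmb I w)) z)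
    {I : ℍ[ℝ]} (hI : I ∈ imagUnits) (z : ℂ) :
    ∃ I' ∈ imagUnits, ‖hermitianForm (h (sliceEmb unitI z)) (h (sliceEmb (-unitI) z))‖ =
      ‖h (sliceEmb I z)‖ * ‖h (sliceEmb I' z)‖ := by
  set u := h (sliceEmb unitI z)
  set v := h (sliceEmb (-unitI) z)
  have hrep : ∀ I ∈ imagUnits, h (sliceEmb I z) =
      (1 / 2 : ℝ) • (u + v) + I * ((1 / 2 : ℝ) • (-(unitI * (u - v)))) := by
    intro I hI
    rw [representation (F := h) hI unitI_mem isOpen_univ isPreconnected_univ (t₀ := 0)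
      (Set.mem_univ _) (fun z _ => hh I hI z) (fun z _ => hh _ unitI_mem z)
      (fun z _ => hh _ (neg_mem_imagUnits unitI_mem) z) (Set.mem_univ z)]
    rw [smul_mul_assoc, smul_mul_assoc, mul_smul_comm, ← smul_add, ← smul_add]
    congr 1
    noncomm_ring
  obtain ⟨I', hI', h'⟩ := exists_norm_mul_norm_eq hI ((1 / 2 : ℝ) • (u + v))
    ((1 / 2 : ℝ) • (-(unitI * (u - v))))
  refine ⟨I', hI', ?_⟩
  rw [hrep I hI, hrep I' hI', ← h', hermitianForm_eq]

/-- The second argument is evaluated at the conjugate point, and the conjugation in the form makes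
it holomorphic in z again. -/
theorem differentiable_hermitianForm {h : ℍ[ℝ] → ℍ[ℝ]}
    (hh : ∀ z, HolomorphicAt unitI (fun w => h (sliceEmb unitI w)) z) :
    Differentiable ℂ
      (fun z => hermitianForm (h (sliceEmb unitI z)) (h (sliceEmb (-unitI) z))) := by
  intro z
  have key : ∀ c, DifferentiableAt ℂ
      (fun z => (starRingEnd ℂ) (complexify unitI c (h (sliceEmb (-unitI) z)))) z := by
    intro c
    simp only [sliceEmb_neg_eq_conj]
    have := (hh ((starRingEnd ℂ) z) c).conj_conj
    rw [Complex.conj_conj] at this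
    exact this
  exact ((hh z _).mul (key _)).add ((hh z _).mul (key _))

/-! ### Rigidity: similarities of the real line and affine functions -/

/-- If all the squared distances from `d x` are multiples of powers of `t - x`, then `d` is a
similarity. -/
theorem exists_norm_sub_eq_mul {d : ℝ → ℍ[ℝ]}
    (hd : ∀ x : ℝ, ∃ (C : ℂ) (M : ℕ), C ≠ 0 ∧
      ∀ t : ℝ, ((‖d t - d x‖ ^ 2 : ℝ) : ℂ) = C * ((t : ℂ) - x) ^ M) :
    ∃ c : ℝ, 0 < c ∧ ∀ x t : ℝ, ‖d t - d x‖ = c * |t - x| := by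
  have h1 : ∀ x : ℝ, ∃ (c : ℝ) (N : ℕ), 0 < c ∧ ∀ t : ℝ, ‖d t - d x‖ = c * |t - x| ^ N := by
    intro x
    obtain ⟨C, M, hC, hM⟩ := hd x
    have hp := hM (x + 1)
    have hm := hM (x - 1)
    have e1 : ((x + 1 : ℝ) : ℂ) - x = 1 := by push_cast; ring
    have e2 : ((x - 1 : ℝ) : ℂ) - x = -1 := by push_cast; ring
    rw [e1, one_pow, mul_one] at hp
    rw [e2] at hm
    -- Evaluation at t = x + 1 shows that C is the real number r, positive because C ≠ 0. At t = x -
    -- 1 an odd M would make a squared norm negative.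
    set r := ‖d (x + 1) - d x‖ ^ 2 with hr
    have hr0 : 0 < r := by
      refine lt_of_le_of_ne (by positivity) fun h => hC ?_
      rw [← hp, ← h, Complex.ofReal_zero]
    rcases Nat.even_or_odd' M with ⟨N, hN | hN⟩
    · refine ⟨√r, N, Real.sqrt_pos.mpr hr0, fun t => ?_⟩
      have ht := hM t
      rw [← hp, hN, pow_mul'] at ht
      have ht' : ‖d t - d x‖ ^ 2 = r * ((t - x) ^ N) ^ 2 := by exact_mod_cast ht
      rw [← abs_pow, ← Real.sqrt_sq_eq_abs, ← Real.sqrt_mul hr0.le, ← ht',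
        Real.sqrt_sq (norm_nonneg _)]
    · exfalso
      rw [hN, (odd_two_mul_add_one N).neg_one_pow, ← hp] at hm
      have hm' : ‖d (x - 1) - d x‖ ^ 2 = -r := by
        have : ((‖d (x - 1) - d x‖ ^ 2 : ℝ) : ℂ) = ((-r : ℝ) : ℂ) := by rw [hm]; simp
        exact_mod_cast this
      nlinarith [sq_nonneg ‖d (x - 1) - d x‖]
  choose c N hc hN using h1
  -- Symmetry of the distance. At distance 1 it shows that c has period 1, and then at distance 2
  -- that N has period 2.
  have hsymm : ∀ x t : ℝ, c x * |t - x| ^ N x = c t * |t - x| ^ N t := by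
    intro x t
    rw [← hN x t, norm_sub_rev, hN t x, abs_sub_comm]
  have hstep : ∀ x, c (x + 1) = c x := fun x => by
    have := hsymm x (x + 1)
    simpa using this.symm
  have hN2 : ∀ x, N (x + 2) = N x := fun x => by
    have h := hsymm x (x + 2)
    have hc2 : c (x + 2) = c x := by
      rw [show x + 2 = x + 1 + 1 by ring, hstep, hstep]
    rw [hc2, add_sub_cancel_left, abs_of_pos two_pos] at h
    exact (pow_right_injective₀ (two_pos : (0 : ℝ) < 2) (by norm_num)
      (mul_left_cancel₀ (hc x).ne' h)).symm
  have hN1 : ∀ x, N x = 1 := by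
    intro x
    have hc2 : c (x + 2) = c x := by
      rw [show x + 2 = x + 1 + 1 by ring, hstep, hstep]
    -- The triangle inequality for x, x + 2, x + 4 gives 4^N ≤ 2 · 2^N.
    have hle : N x ≤ 1 := by
      have htri := norm_sub_le_norm_sub_add_norm_sub (d (x + 2 + 2)) (d (x + 2)) (d x)
      rw [hN x, hN (x + 2), hN x, hN2, hc2] at htri
      have a1 : |x + 2 + 2 - x| = 2 * 2 := by
        rw [show x + 2 + 2 - x = 2 * 2 by ring]; norm_num
      have a2 : |x + 2 + 2 - (x + 2)| = 2 := by
        rw [show x + 2 + 2 - (x + 2) = 2 by ring]; norm_num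
      have a3 : |x + 2 - x| = 2 := by
        rw [show x + 2 - x = 2 by ring]; norm_num
      rw [a1, a2, a3, mul_pow] at htri
      have hpos : 0 < c x * 2 ^ N x := mul_pos (hc x) (by positivity)
      have h2 : (2 : ℝ) ^ N x ≤ 2 ^ 1 := by
        by_contra hlt
        push Not at hlt
        nlinarith
      exact (pow_le_pow_iff_right₀ (by norm_num)).mp h2
    have hne : N x ≠ 0 := by
      intro h0
      have := hN x x
      rw [h0] at this
      simp at this
      exact (hc x).ne this
    omega
  refine ⟨c 0, hc 0, fun x t => ?_⟩
  rw [hN x t, hN1, pow_one]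
  by_cases hx : x = 0
  · rw [hx]
  · have := hsymm 0 x
    rw [hN1, hN1, sub_zero, pow_one] at this
    rw [mul_right_cancel₀ (abs_ne_zero.mpr hx) this]

/-- Up to the factor c, this is an isometric embedding of ℝ into a strictly convex space, and such
maps are affine. -/
theorem exists_affine_of_norm_sub_eq {d : ℝ → ℍ[ℝ]} {c : ℝ} (hc : 0 < c)
    (hd : ∀ x t : ℝ, ‖d t - d x‖ = c * |t - x|) :
    ∃ a b : ℍ[ℝ], ∀ t : ℝ, d t = (t : ℍ[ℝ]) * a + b := by
  have hiso : Isometry (fun t => c⁻¹ • d t) := by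
    refine Isometry.of_dist_eq fun t x => ?_
    rw [dist_eq_norm, ← smul_sub, norm_smul, hd, Real.norm_of_nonneg (inv_nonneg.mpr hc.le),
      Real.dist_eq, inv_mul_cancel_left₀ hc.ne']
  set φ := hiso.affineIsometryOfStrictConvexSpace with hφ
  refine ⟨c • φ.linear 1, d 0, fun t => ?_⟩
  have h1 : φ t = t • φ.linear 1 + φ 0 := by
    have := φ.toAffineMap.map_vadd 0 t
    have h2 := φ.linear.map_smul t 1
    rw [smul_eq_mul, mul_one] at h2
    rw [vadd_eq_add, add_zero, vadd_eq_add] at this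
    rw [← h2]
    exact this
  have h2 : c⁻¹ • d t = t • φ.linear 1 + c⁻¹ • d 0 := h1
  have h3 := congrArg (c • ·) h2
  simp only [smul_add, smul_smul, mul_inv_cancel₀ hc.ne', one_smul] at h3
  rw [h3, Quaternion.coe_mul_eq_smul, smul_smul, mul_comm]

/-- Injective entire slice functions that tend to infinity at infinity are affine. -/
theorem exists_affine_of_injective {g : ℍ[ℝ] → ℍ[ℝ]} (hinj : Function.Injective g)
    (hg : ∀ I ∈ imagUnits, ∀ z, HolomorphicAt I (fun w => g (sliceEmb I w)) z)
    (hinf : Tendsto g (cocompact ℍ[ℝ]) (cocompact ℍ[ℝ])) :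
    ∃ a b : ℍ[ℝ], a ≠ 0 ∧ ∀ q, g q = q * a + b := by
  have hreal : ∀ x : ℝ, ∃ (C : ℂ) (M : ℕ), C ≠ 0 ∧
      ∀ t : ℝ, ((‖g t - g x‖ ^ 2 : ℝ) : ℂ) = C * ((t : ℂ) - x) ^ M := by
    intro x
    let h : ℍ[ℝ] → ℍ[ℝ] := fun q => g q - g x
    have hh : ∀ I ∈ imagUnits, ∀ z, HolomorphicAt I (fun w => h (sliceEmb I w)) z :=
      fun I hI z => (hg I hI z).sub (holomorphicAt_const _ _ _)
    have hzero : ∀ z : ℂ, z ≠ x →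
        hermitianForm (h (sliceEmb unitI z)) (h (sliceEmb (-unitI) z)) ≠ 0 := by
      intro z hz h0
      obtain ⟨I', hI', h'⟩ := exists_norm_hermitianForm_eq hh unitI_mem z
      rw [h0, norm_zero] at h'
      have hne : ∀ I ∈ imagUnits, ‖h (sliceEmb I z)‖ ≠ 0 := by
        intro I hI hI0
        refine hz (sliceEmb_injective hI ?_)
        rw [sliceEmb_ofReal]
        exact hinj (sub_eq_zero.mp (norm_eq_zero.mp hI0))
      exact mul_ne_zero (hne _ unitI_mem) (hne _ hI') h'.symm
    have hlim : Tendsto (fun z => hermitianForm (h (sliceEmb unitI z)) (h (sliceEmb (-unitI) z)))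
        (cocompact ℂ) (cocompact ℂ) := by
      have hinf' : Tendsto (fun q => ‖h q‖) (cocompact ℍ[ℝ]) atTop := by
        have e1 : Tendsto (fun q : ℍ[ℝ] => q - g x) (cocompact ℍ[ℝ]) (cocompact ℍ[ℝ]) :=
          (Homeomorph.subRight (g x)).isClosedEmbedding.tendsto_cocompact
        exact tendsto_norm_cocompact_atTop.comp (e1.comp hinf)
      rw [← Metric.cobounded_eq_cocompact,
        ← tendsto_norm_atTop_iff_cobounded, tendsto_atTop]
      intro B
      -- Two factors that are both at least max B 1 have product at least B, even when B < 1.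
      have ev := hinf'.eventually_ge_atTop (max B 1)
      rw [← Metric.cobounded_eq_cocompact, ← comap_norm_atTop, eventually_comap,
        eventually_atTop] at ev
      obtain ⟨R, hR⟩ := ev
      rw [← comap_norm_atTop, eventually_comap]
      filter_upwards [eventually_ge_atTop R] with r hr z hz
      obtain ⟨I', hI', h'⟩ := exists_norm_hermitianForm_eq hh unitI_mem z
      have b1 := hR r hr (sliceEmb unitI z) (by rw [norm_sliceEmb unitI_mem, hz])
      have b2 := hR r hr (sliceEmb I' z) (by rw [norm_sliceEmb hI', hz])
      rw [h']
      nlinarith [le_max_left B 1, le_max_right B 1]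
    obtain ⟨C, M, hC, hM⟩ := exists_eq_const_mul_pow
      (differentiable_hermitianForm (hh _ unitI_mem)) x hzero hlim
    refine ⟨C, M, hC, fun t => ?_⟩
    rw [← hM, sliceEmb_ofReal, sliceEmb_ofReal, hermitianForm_self]
  obtain ⟨c, hc, hd⟩ := exists_norm_sub_eq_mul (d := fun t => g t) hreal
  obtain ⟨a, b, hab⟩ := exists_affine_of_norm_sub_eq hc hd
  have hall : ∀ q, g q = q * a + b := by
    intro q
    obtain ⟨I, hI, z, rfl⟩ := exists_sliceEmb q
    rw [← sub_eq_zero]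
    refine eq_zero_of_eq_zero_on_reals (I := I)
      (g := fun z => g (sliceEmb I z) - (sliceEmb I z * a + b)) isOpen_univ isPreconnected_univ
      (fun z _ => (hg I hI z).sub ((holomorphicAt_sliceEmb_mul hI a z).add
        (holomorphicAt_const I b z))) (t₀ := 0) (Set.mem_univ _) (fun t _ => ?_) (Set.mem_univ z)
    rw [sliceEmb_ofReal, hab, sub_self]
  refine ⟨a, b, fun ha => ?_, hall⟩
  have : (0 : ℍ[ℝ]) = 1 := hinj (by rw [hall, hall, ha, mul_zero, mul_zero])
  exact zero_ne_one this

/-! ### Explicit formulas for regular quotients of affine series -/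

theorem coeff_zero_affineSeries_mul (c d : ℍ[ℝ]) (g : PowerSeries ℍ[ℝ]) :
    PowerSeries.coeff 0 (affineSeries c d * g) = d * PowerSeries.coeff 0 g := by
  rw [affineSeries, add_mul, mul_assoc, map_add, PowerSeries.coeff_zero_X_mul,
    PowerSeries.coeff_C_mul, zero_add]

theorem coeff_succ_affineSeries_mul (c d : ℍ[ℝ]) (g : PowerSeries ℍ[ℝ]) (n : ℕ) :
    PowerSeries.coeff (n + 1) (affineSeries c d * g) =
      c * PowerSeries.coeff n g + d * PowerSeries.coeff (n + 1) g := by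
  rw [affineSeries, add_mul, mul_assoc, map_add, PowerSeries.coeff_succ_X_mul,
    PowerSeries.coeff_C_mul, PowerSeries.coeff_C_mul]

theorem coeff_affineSeries (a b : ℍ[ℝ]) (n : ℕ) :
    PowerSeries.coeff n (affineSeries a b) = if n = 0 then b else if n = 1 then a else 0 := by
  rw [affineSeries, map_add]
  match n with
  | 0 => simp
  | 1 => simp
  | n + 2 => simp [PowerSeries.coeff_X]

theorem regConj_affineSeries (c d : ℍ[ℝ]) :
    regConj (affineSeries c d) = affineSeries (star c) (star d) := by
  ext1 n
  simp only [regConj, PowerSeries.coeff_mk, coeff_affineSeries]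
  split_ifs <;> simp

theorem evalSeries_affineSeries_mul (a b c d q : ℍ[ℝ]) :
    evalSeries (affineSeries c d * affineSeries a b) q =
      d * b + q * (c * b + d * a) + q ^ 2 * (c * a) := by
  rw [evalSeries, tsum_eq_sum (s := Finset.range 3)]
  · simp [Finset.sum_range_succ, coeff_zero_affineSeries_mul, coeff_succ_affineSeries_mul,
      coeff_affineSeries]
  · intro n hn
    obtain ⟨m, rfl⟩ : ∃ m, n = m + 2 + 1 := ⟨n - 3, by simp at hn; omega⟩
    simp [coeff_succ_affineSeries_mul, coeff_affineSeries]

theorem mem_regFracDomain (A : GL2H) (q : ℍ[ℝ]) :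
    q ∈ regFracDomain A ↔ A.val 1 1 * star (A.val 1 1) +
      q * (A.val 0 1 * star (A.val 1 1) + A.val 1 1 * star (A.val 0 1)) +
      q ^ 2 * (A.val 0 1 * star (A.val 0 1)) ≠ 0 := by
  rw [regFracDomain, regQuotDomain, Set.mem_ofPred_eq, symmetrization, regConj_affineSeries,
    evalSeries_affineSeries_mul]

theorem regFrac_apply (A : GL2H) (q : ℍ[ℝ]) :
    regFrac A q = (A.val 1 1 * star (A.val 1 1) +
      q * (A.val 0 1 * star (A.val 1 1) + A.val 1 1 * star (A.val 0 1)) +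
      q ^ 2 * (A.val 0 1 * star (A.val 0 1)))⁻¹ *
      (star (A.val 1 1) * A.val 1 0 +
        q * (star (A.val 0 1) * A.val 1 0 + star (A.val 1 1) * A.val 0 0) +
        q ^ 2 * (star (A.val 0 1) * A.val 0 0)) := by
  rw [regFrac, regQuot, symmetrization, regConj_affineSeries, evalSeries_affineSeries_mul,
    evalSeries_affineSeries_mul]

/-! ### Linear fractional transformations are homeomorphisms -/

theorem linFrac_infty_of_eq {A : GL2H} (h : A.val 0 1 = 0) :
    linFrac A OnePoint.infty = OnePoint.infty := if_pos h

theorem linFrac_infty_of_ne {A : GL2H} (h : A.val 0 1 ≠ 0) :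
    linFrac A OnePoint.infty = (((A.val 0 1)⁻¹ * A.val 0 0 : ℍ[ℝ]) : OnePoint ℍ[ℝ]) := if_neg h

theorem linFrac_coe_of_eq {A : GL2H} {q : ℍ[ℝ]} (h : q * A.val 0 1 + A.val 1 1 = 0) :
    linFrac A (q : OnePoint ℍ[ℝ]) = OnePoint.infty := if_pos h

theorem linFrac_coe_of_ne {A : GL2H} {q : ℍ[ℝ]} (h : q * A.val 0 1 + A.val 1 1 ≠ 0) :
    linFrac A (q : OnePoint ℍ[ℝ]) =
      (((q * A.val 0 1 + A.val 1 1)⁻¹ * (q * A.val 0 0 + A.val 1 0) : ℍ[ℝ]) :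
        OnePoint ℍ[ℝ]) := if_neg h

theorem entries_mul_inv (A : GL2H) :
    A.val 0 0 * (A⁻¹).val 0 0 + A.val 0 1 * (A⁻¹).val 1 0 = 1 ∧
    A.val 0 0 * (A⁻¹).val 0 1 + A.val 0 1 * (A⁻¹).val 1 1 = 0 ∧
    A.val 1 0 * (A⁻¹).val 0 0 + A.val 1 1 * (A⁻¹).val 1 0 = 0 ∧
    A.val 1 0 * (A⁻¹).val 0 1 + A.val 1 1 * (A⁻¹).val 1 1 = 1 := by
  have h := A.mul_inv
  have e := fun i j => congrFun (congrFun h i) j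
  have h00 := e 0 0
  have h01 := e 0 1
  have h10 := e 1 0
  have h11 := e 1 1
  simp only [Matrix.mul_apply, Fin.sum_univ_two] at h00 h01 h10 h11
  exact ⟨by simpa using h00, by simpa using h01, by simpa using h10, by simpa using h11⟩

/-- In homogeneous coordinates up to left scalars, the transformation is (q, 1) ↦ (q, 1)A = (u, v),
read as v⁻¹u. Multiplication by A⁻¹ undoes it, and the cases only separate the points at infinity.
-/
theorem linFrac_inv_linFrac (A : GL2H) (p : OnePoint ℍ[ℝ]) :
    linFrac A⁻¹ (linFrac A p) = p := by
  obtain ⟨h00, h01, h10, h11⟩ := entries_mul_inv A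
  induction p using OnePoint.rec with
  | infty =>
    by_cases hc : A.val 0 1 = 0
    · rw [linFrac_infty_of_eq hc]
      refine linFrac_infty_of_eq ?_
      rw [hc, zero_mul, add_zero] at h00 h01
      exact (mul_eq_zero.mp h01).resolve_left (left_ne_zero_of_mul_eq_one h00)
    · rw [linFrac_infty_of_ne hc]
      refine linFrac_coe_of_eq ?_
      have : (A.val 0 1)⁻¹ * (A.val 0 0 * (A⁻¹).val 0 1 + A.val 0 1 * (A⁻¹).val 1 1) = 0 := by
        rw [h01, mul_zero]
      rwa [mul_add, ← mul_assoc, inv_mul_cancel_left₀ hc] at this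
  | coe q =>
    set u := q * A.val 0 0 + A.val 1 0 with hu
    set v := q * A.val 0 1 + A.val 1 1 with hv
    have e1 : u * (A⁻¹).val 0 0 + v * (A⁻¹).val 1 0 = q := by
      have : u * (A⁻¹).val 0 0 + v * (A⁻¹).val 1 0 =
          q * (A.val 0 0 * (A⁻¹).val 0 0 + A.val 0 1 * (A⁻¹).val 1 0) +
          (A.val 1 0 * (A⁻¹).val 0 0 + A.val 1 1 * (A⁻¹).val 1 0) := by
        rw [hu, hv]; noncomm_ring
      rw [this, h00, h10, mul_one, add_zero]
    have e2 : u * (A⁻¹).val 0 1 + v * (A⁻¹).val 1 1 = 1 := by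
      have : u * (A⁻¹).val 0 1 + v * (A⁻¹).val 1 1 =
          q * (A.val 0 0 * (A⁻¹).val 0 1 + A.val 0 1 * (A⁻¹).val 1 1) +
          (A.val 1 0 * (A⁻¹).val 0 1 + A.val 1 1 * (A⁻¹).val 1 1) := by
        rw [hu, hv]; noncomm_ring
      rw [this, h01, h11, mul_zero, zero_add]
    by_cases hv0 : v = 0
    · rw [linFrac_coe_of_eq hv0]
      rw [hv0, zero_mul, add_zero] at e1 e2
      rw [linFrac_infty_of_ne (right_ne_zero_of_mul_eq_one e2), inv_eq_of_mul_eq_one_left e2, e1]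
    · rw [linFrac_coe_of_ne hv0]
      have f2 : v⁻¹ * u * (A⁻¹).val 0 1 + (A⁻¹).val 1 1 = v⁻¹ := by
        have := congrArg (v⁻¹ * ·) e2
        simpa only [mul_add, ← mul_assoc, inv_mul_cancel₀ hv0, one_mul, mul_one] using this
      have f1 : v⁻¹ * u * (A⁻¹).val 0 0 + (A⁻¹).val 1 0 = v⁻¹ * q := by
        have := congrArg (v⁻¹ * ·) e1
        simpa only [mul_add, ← mul_assoc, inv_mul_cancel₀ hv0, one_mul, mul_one] using this
      rw [linFrac_coe_of_ne (by rw [f2]; exact inv_ne_zero hv0), f1, f2, inv_inv,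
        mul_inv_cancel_left₀ hv0]

theorem tendsto_coe_infty_of_tendsto_norm {X : Type*} {l : Filter X} {g : X → ℍ[ℝ]}
    (hg : Tendsto (fun x => ‖g x‖) l atTop) :
    Tendsto (fun x => (g x : OnePoint ℍ[ℝ])) l (𝓝 OnePoint.infty) := by
  refine OnePoint.tendsto_coe_infty.comp ?_
  rw [coclosedCompact_eq_cocompact, ← Metric.cobounded_eq_cocompact]
  exact tendsto_norm_atTop_iff_cobounded.mp hg

theorem continuousAt_linFrac_coe (A : GL2H) (q₀ : ℍ[ℝ]) :
    ContinuousAt (fun q : ℍ[ℝ] => linFrac A (q : OnePoint ℍ[ℝ])) q₀ := by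
  obtain ⟨h00, h01, h10, h11⟩ := entries_mul_inv A
  have hden : Continuous fun q : ℍ[ℝ] => q * A.val 0 1 + A.val 1 1 := by fun_prop
  have hnum : Continuous fun q : ℍ[ℝ] => q * A.val 0 0 + A.val 1 0 := by fun_prop
  by_cases h0 : q₀ * A.val 0 1 + A.val 1 1 = 0
  · have hc : A.val 0 1 ≠ 0 := by
      intro hc
      rw [hc, mul_zero, zero_add] at h0
      rw [hc, zero_mul, add_zero] at h00 h01
      rw [h0, zero_mul, add_zero] at h11
      exact mul_ne_zero (left_ne_zero_of_mul_eq_one h00) (right_ne_zero_of_mul_eq_one h11) h01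
    -- The row (q₀, 1)A cannot vanish since A is invertible, so numerator and denominator have no
    -- common zero.
    have hnum0 : q₀ * A.val 0 0 + A.val 1 0 ≠ 0 := by
      intro hn
      have : (q₀ * A.val 0 0 + A.val 1 0) * (A⁻¹).val 0 1 +
          (q₀ * A.val 0 1 + A.val 1 1) * (A⁻¹).val 1 1 =
          q₀ * (A.val 0 0 * (A⁻¹).val 0 1 + A.val 0 1 * (A⁻¹).val 1 1) +
          (A.val 1 0 * (A⁻¹).val 0 1 + A.val 1 1 * (A⁻¹).val 1 1) := by noncomm_ring
      rw [hn, h0, h01, h11] at this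
      simp at this
    have hne : ∀ q, q ≠ q₀ → q * A.val 0 1 + A.val 1 1 ≠ 0 := by
      intro q hq h
      have : (q - q₀) * A.val 0 1 = 0 := by
        rw [sub_mul, ← add_sub_add_right_eq_sub _ _ (A.val 1 1), h, h0, sub_self]
      exact mul_ne_zero (sub_ne_zero.mpr hq) hc this
    rw [continuousAt_iff_punctured_nhds, linFrac_coe_of_eq h0]
    have hev : (fun q : ℍ[ℝ] => (((q * A.val 0 1 + A.val 1 1)⁻¹ * (q * A.val 0 0 + A.val 1 0) :
        ℍ[ℝ]) : OnePoint ℍ[ℝ])) =ᶠ[𝓝[≠] q₀] fun q => linFrac A (q : OnePoint ℍ[ℝ]) := by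
      filter_upwards [self_mem_nhdsWithin] with q hq
      rw [linFrac_coe_of_ne (hne q hq)]
    refine Tendsto.congr' hev (tendsto_coe_infty_of_tendsto_norm ?_)
    have t1 : Tendsto (fun q : ℍ[ℝ] => q * A.val 0 1 + A.val 1 1) (𝓝[≠] q₀) (𝓝[≠] 0) := by
      refine tendsto_nhdsWithin_iff.mpr ⟨?_, ?_⟩
      · rw [← h0]
        exact (hden.tendsto q₀).mono_left nhdsWithin_le_nhds
      · filter_upwards [self_mem_nhdsWithin] with q hq using hne q hq
    have t2 := tendsto_norm_atTop_iff_cobounded.mpr (Filter.tendsto_inv₀_nhdsNE_zero.comp t1)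
    have t3 : Tendsto (fun q : ℍ[ℝ] => ‖q * A.val 0 0 + A.val 1 0‖) (𝓝[≠] q₀)
        (𝓝 ‖q₀ * A.val 0 0 + A.val 1 0‖) :=
      (hnum.norm.tendsto q₀).mono_left nhdsWithin_le_nhds
    simp only [norm_mul]
    exact t2.atTop_mul_pos (norm_pos_iff.mpr hnum0) t3
  · have hev : (fun q : ℍ[ℝ] => linFrac A (q : OnePoint ℍ[ℝ])) =ᶠ[𝓝 q₀]
        fun q : ℍ[ℝ] => (((q * A.val 0 1 + A.val 1 1)⁻¹ * (q * A.val 0 0 + A.val 1 0) :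
        ℍ[ℝ]) : OnePoint ℍ[ℝ]) := by
      filter_upwards [hden.continuousAt.eventually_ne h0] with q hq
      exact linFrac_coe_of_ne hq
    refine ContinuousAt.congr_of_eventuallyEq ?_ hev
    exact OnePoint.continuous_coe.continuousAt.comp
      ((hden.continuousAt.inv₀ h0).mul hnum.continuousAt)

theorem tendsto_linFrac_infty (A : GL2H) :
    Tendsto (fun q : ℍ[ℝ] => linFrac A (q : OnePoint ℍ[ℝ])) (coclosedCompact ℍ[ℝ])
      (𝓝 (linFrac A OnePoint.infty)) := by
  obtain ⟨h00, h01, h10, h11⟩ := entries_mul_inv A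
  rw [coclosedCompact_eq_cocompact]
  by_cases hc : A.val 0 1 = 0
  · rw [linFrac_infty_of_eq hc]
    rw [hc, zero_mul, add_zero] at h00 h01
    have ha := left_ne_zero_of_mul_eq_one h00
    have hd : A.val 1 1 ≠ 0 := by
      rw [(mul_eq_zero.mp h01).resolve_left ha, mul_zero, zero_add] at h11
      exact left_ne_zero_of_mul_eq_one h11
    have hev : (fun q : ℍ[ℝ] => (((A.val 1 1)⁻¹ * (q * A.val 0 0 + A.val 1 0) : ℍ[ℝ]) :
        OnePoint ℍ[ℝ])) = fun q : ℍ[ℝ] => linFrac A (q : OnePoint ℍ[ℝ]) := by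
      funext q
      rw [linFrac_coe_of_ne (by rw [hc, mul_zero, zero_add]; exact hd), hc, mul_zero, zero_add]
    rw [← hev]
    refine tendsto_coe_infty_of_tendsto_norm (tendsto_norm_cocompact_atTop.comp ?_)
    exact (((Homeomorph.mulRight₀ _ ha).trans (Homeomorph.addRight (A.val 1 0))).trans
      (Homeomorph.mulLeft₀ _ (inv_ne_zero hd))).isClosedEmbedding.tendsto_cocompact
  · rw [linFrac_infty_of_ne hc]
    have hinv : Tendsto (fun q : ℍ[ℝ] => q⁻¹) (cocompact ℍ[ℝ]) (𝓝 0) := by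
      rw [← Metric.cobounded_eq_cocompact]
      exact Filter.tendsto_inv₀_cobounded
    have hne : ∀ᶠ q in cocompact ℍ[ℝ], q ≠ 0 := isCompact_singleton.compl_mem_cocompact
    have tden : Tendsto (fun q : ℍ[ℝ] => A.val 0 1 + q⁻¹ * A.val 1 1) (cocompact ℍ[ℝ])
        (𝓝 (A.val 0 1)) := by
      simpa using (hinv.mul_const (A.val 1 1)).const_add (A.val 0 1)
    have tnum : Tendsto (fun q : ℍ[ℝ] => A.val 0 0 + q⁻¹ * A.val 1 0) (cocompact ℍ[ℝ])
        (𝓝 (A.val 0 0)) := by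
      simpa using (hinv.mul_const (A.val 1 0)).const_add (A.val 0 0)
    refine ((OnePoint.continuous_coe.tendsto _).comp ((tden.inv₀ hc).mul tnum)).congr' ?_
    filter_upwards [hne, tden.eventually_ne hc] with q hq hq'
    have e1 : q * A.val 0 1 + A.val 1 1 = q * (A.val 0 1 + q⁻¹ * A.val 1 1) := by
      rw [mul_add, mul_inv_cancel_left₀ hq]
    have e2 : q * A.val 0 0 + A.val 1 0 = q * (A.val 0 0 + q⁻¹ * A.val 1 0) := by
      rw [mul_add, mul_inv_cancel_left₀ hq]
    rw [linFrac_coe_of_ne (by rw [e1]; exact mul_ne_zero hq hq'), e1, e2, mul_inv_rev, mul_assoc,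
      inv_mul_cancel_left₀ hq]
    rfl

theorem continuous_linFrac (A : GL2H) : Continuous (linFrac A) := by
  rw [OnePoint.continuous_iff]
  exact ⟨tendsto_linFrac_infty A, continuous_iff_continuousAt.mpr (continuousAt_linFrac_coe A)⟩

/-- Linear fractional transformations are homeomorphisms. -/
def linFracHomeomorph (A : GL2H) : OnePoint ℍ[ℝ] ≃ₜ OnePoint ℍ[ℝ] where
  toFun := linFrac A
  invFun := linFrac A⁻¹
  left_inv := linFrac_inv_linFrac A
  right_inv p := by simpa using linFrac_inv_linFrac A⁻¹ p
  continuous_toFun := continuous_linFrac A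
  continuous_invFun := continuous_linFrac A⁻¹

/-! ### Poles of regular fractional transformations in ℝ ∪ {∞} -/

theorem coe_mem_slice (I : ℍ[ℝ]) (x : ℝ) : (x : ℍ[ℝ]) ∈ slice I := ⟨x, 0, by simp⟩

/-- A function that extends continuously to a real point has no pole there. -/
theorem not_hasPoleAt_of_continuousAt {Ω : Set ℍ[ℝ]} {f g : ℍ[ℝ] → ℍ[ℝ]} {x : ℝ}
    (hg : ContinuousAt g (x : ℍ[ℝ])) (hfg : ∀ q, q ≠ (x : ℍ[ℝ]) → f q = g q) :
    ¬ HasPoleAt Ω f (x : ℍ[ℝ]) := by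
  classical
  intro hpole
  obtain ⟨R, a, N, ⟨hR, hL⟩, hfin, m₀, hm₀, ham₀⟩ := hpole unitI unitI_mem (coe_mem_slice _ x)
  have hm₀N : m₀ ≤ N := by
    by_contra h
    exact ham₀ (hfin m₀ (not_le.mp h))
  -- The exact order of the pole.
  set m := Nat.findGreatest (fun m : ℕ => a (-(m : ℤ)) ≠ 0) N with hm
  have ham : a (-(m : ℤ)) ≠ 0 := Nat.findGreatest_spec (P := fun m : ℕ => a (-(m : ℤ)) ≠ 0) hm₀N ham₀
  have hmpos : m ≠ 0 :=
    (hm₀.trans_le (Nat.le_findGreatest (P := fun m : ℕ => a (-(m : ℤ)) ≠ 0) hm₀N ham₀)).ne'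
  have hgt : ∀ k : ℕ, m < k → a (-(k : ℤ)) = 0 := by
    intro k hk
    by_cases hkN : k ≤ N
    · exact not_not.mp (Nat.findGreatest_is_greatest hk hkN)
    · exact hfin k (not_le.mp hkN)
  -- Along the ray x + t, the factor t^m turns the Laurent series into a power series with constant
  -- term `a (-m)`. Its limit as t → 0 is therefore `a (-m)`, whereas continuity of g gives the
  -- limit 0.
  have hsum : ∀ t : ℝ, 0 < t → t < R →
      HasSum (fun k : ℕ => (t : ℍ[ℝ]) ^ k * a (k - m)) ((t : ℍ[ℝ]) ^ m * g (x + t)) := by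
    intro t ht htR
    have ht0 : (t : ℍ[ℝ]) ≠ 0 := by
      rw [← norm_ne_zero_iff, Quaternion.norm_coe, Real.norm_eq_abs]
      exact abs_ne_zero.mpr ht.ne'
    have hz : ((x + t : ℝ) : ℍ[ℝ]) - x = t := by rw [Quaternion.coe_add, add_sub_cancel_left]
    have hzx : ((x + t : ℝ) : ℍ[ℝ]) ≠ x := by rw [← sub_ne_zero, hz]; exact ht0
    have h1 := (hL _ (coe_mem_slice _ (x + t)) hzx
      (by rw [hz, Quaternion.norm_coe, Real.norm_of_nonneg ht.le]; exact htR)).2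
    rw [hz, hfg _ hzx, Quaternion.coe_add] at h1
    have h2 := h1.mul_left ((t : ℍ[ℝ]) ^ m)
    have h3 : HasSum (fun k : ℤ => (t : ℍ[ℝ]) ^ k * a (k - m)) ((t : ℍ[ℝ]) ^ m * g (x + t)) := by
      rw [← (Equiv.addRight (m : ℤ)).hasSum_iff]
      refine h2.congr_fun fun n => ?_
      simp only [Function.comp_apply, Equiv.coe_addRight, add_sub_cancel_right]
      rw [← mul_assoc, ← zpow_natCast, ← zpow_add₀ ht0, add_comm]
    rw [← (Nat.cast_injective (R := ℤ)).hasSum_iff] at h3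
    · simpa only [Function.comp_def, zpow_natCast] using h3
    · intro k hk
      have hk0 : k < 0 := by
        by_contra h
        exact hk ⟨k.toNat, Int.toNat_of_nonneg (not_lt.mp h)⟩
      have := hgt (m + (-k).toNat) (by omega)
      rw [show -((m + (-k).toNat : ℕ) : ℤ) = k - m by omega] at this
      rw [this, mul_zero]
  -- Convergence at t = R/2 bounds the terms there by B, so for t < R/4 they are dominated by B ·
  -- 2⁻ᵏ.
  obtain ⟨B, hB⟩ : ∃ B : ℝ, ∀ k : ℕ, ‖((R / 2 : ℝ) : ℍ[ℝ]) ^ k * a (k - m)‖ ≤ B := by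
    have h := (hsum (R / 2) (by positivity) (by linarith)).summable.tendsto_atTop_zero.norm
    obtain ⟨B, hB⟩ := h.bddAbove_range
    exact ⟨B, fun k => hB ⟨k, rfl⟩⟩
  have hlim : Tendsto (fun t : ℝ => ∑' k : ℕ, (t : ℍ[ℝ]) ^ k * a (k - m)) (𝓝[>] 0)
      (𝓝 (∑' k : ℕ, ((0 : ℝ) : ℍ[ℝ]) ^ k * a (k - m))) := by
    refine tendsto_tsum_of_dominated_convergence (bound := fun k => B * (1 / 2 : ℝ) ^ k)
      ((summable_geometric_of_lt_one (by norm_num) (by norm_num)).mul_left B) (fun k => ?_) ?_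
    · have hc : Continuous fun t : ℝ => (t : ℍ[ℝ]) ^ k * a (k - m) :=
        (Quaternion.continuous_coe.pow k).mul continuous_const
      exact (hc.tendsto 0).mono_left nhdsWithin_le_nhds
    · filter_upwards [Ioo_mem_nhdsGT (show (0 : ℝ) < R / 4 by positivity)] with t ht k
      have h1 := hB k
      rw [norm_mul, norm_pow, Quaternion.norm_coe, Real.norm_of_nonneg (by positivity)] at h1
      rw [norm_mul, norm_pow, Quaternion.norm_coe, Real.norm_of_nonneg ht.1.le]
      have h2 : t ^ k ≤ (R / 2) ^ k * (1 / 2) ^ k := by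
        rw [← mul_pow]
        exact pow_le_pow_left₀ ht.1.le (by linarith [ht.2]) k
      calc t ^ k * ‖a (k - m)‖ ≤ (R / 2) ^ k * (1 / 2) ^ k * ‖a (k - m)‖ := by gcongr
        _ = (R / 2) ^ k * ‖a (k - m)‖ * (1 / 2) ^ k := by ring
        _ ≤ B * (1 / 2) ^ k := by gcongr
  have hlim0 : Tendsto (fun t : ℝ => ∑' k : ℕ, (t : ℍ[ℝ]) ^ k * a (k - m)) (𝓝[>] 0) (𝓝 0) := by
    have h1 : Tendsto (fun t : ℝ => (t : ℍ[ℝ]) ^ m * g (x + t)) (𝓝[>] 0)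
        (𝓝 (((0 : ℝ) : ℍ[ℝ]) ^ m * g x)) := by
      have hxt : Tendsto (fun t : ℝ => (x : ℍ[ℝ]) + t) (𝓝[>] 0) (𝓝 (x : ℍ[ℝ])) := by
        have := (Quaternion.continuous_coe.tendsto 0).const_add (x : ℍ[ℝ])
        rw [Quaternion.coe_zero, add_zero] at this
        exact this.mono_left nhdsWithin_le_nhds
      exact (((Quaternion.continuous_coe.pow m).tendsto 0).mono_left nhdsWithin_le_nhds).mul
        (hg.tendsto.comp hxt)
    rw [Quaternion.coe_zero, zero_pow hmpos, zero_mul] at h1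
    refine h1.congr' ?_
    filter_upwards [Ioo_mem_nhdsGT hR] with t ht
    exact (hsum t ht.1 ht.2).tsum_eq.symm
  have heq := tendsto_nhds_unique hlim hlim0
  rw [tsum_eq_single 0 (fun k hk => by rw [Quaternion.coe_zero, zero_pow hk, zero_mul]), pow_zero,
    one_mul, Nat.cast_zero, zero_sub] at heq
  exact ham heq

theorem entry_ne_zero_of_eq_zero {A : GL2H} (h : A.val 0 1 = 0) : A.val 1 1 ≠ 0 := by
  have h11 := (entries_mul_inv A⁻¹).2.2.2
  rw [inv_inv, h, mul_zero, zero_add] at h11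
  exact right_ne_zero_of_mul_eq_one h11

/-- At a real x the symmetrized denominator is (xc + d) times its conjugate. Unless it vanishes, the
quotient is continuous at x and has no pole there. -/
theorem eq_of_hasPoleAt_regFrac {A : GL2H} {x : ℝ}
    (h : HasPoleAt (regFracDomain A) (regFrac A) (x : ℍ[ℝ])) :
    A.val 0 1 ≠ 0 ∧ A.val 1 1 = -((x : ℍ[ℝ]) * A.val 0 1) := by
  have hx : (x : ℍ[ℝ]) ∉ regFracDomain A := by
    intro hx
    rw [mem_regFracDomain] at hx
    refine not_hasPoleAt_of_continuousAt (g := regFrac A) ?_ (fun _ _ => rfl) h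
    simp only [funext (regFrac_apply A)]
    exact ContinuousAt.mul (ContinuousAt.inv₀ (by fun_prop) hx) (by fun_prop)
  rw [mem_regFracDomain, not_not] at hx
  have hfac : ((x : ℍ[ℝ]) * A.val 0 1 + A.val 1 1) * star ((x : ℍ[ℝ]) * A.val 0 1 + A.val 1 1) =
      0 := by
    rw [← hx]
    simp only [Quaternion.coe_mul_eq_smul, star_add, Quaternion.star_smul, mul_add, add_mul,
      smul_mul_assoc, mul_smul_comm, ← Quaternion.coe_pow]
    module
  have h0 : (x : ℍ[ℝ]) * A.val 0 1 + A.val 1 1 = 0 := by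
    rcases mul_eq_zero.mp hfac with h | h
    · exact h
    · exact star_eq_zero.mp h
  have hd : A.val 1 1 = -((x : ℍ[ℝ]) * A.val 0 1) := eq_neg_of_add_eq_zero_right h0
  refine ⟨fun hc => entry_ne_zero_of_eq_zero hc ?_, hd⟩
  rw [hd, hc, mul_zero, neg_zero]

/-- After cancelling q⁻², the transformation at q⁻¹ has a denominator with value cc̄ at q = 0. If c
≠ 0 it thus extends continuously to 0. -/
theorem eq_zero_of_hasPoleAtInfty_regFrac {A : GL2H}
    (h : HasPoleAtInfty (regFracDomain A) (regFrac A)) : A.val 0 1 = 0 := by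
  by_contra hc
  set a := A.val 0 0 with ha
  set b := A.val 1 0 with hb
  set c := A.val 0 1 with hc'
  set d := A.val 1 1 with hd
  have h' : HasPoleAt {q | q ≠ 0 ∧ q⁻¹ ∈ regFracDomain A} (fun q => regFrac A q⁻¹)
      ((0 : ℝ) : ℍ[ℝ]) := by rw [Quaternion.coe_zero]; exact h
  refine not_hasPoleAt_of_continuousAt
    (g := fun q => (q ^ 2 * (d * star d) + q * (c * star d + d * star c) + c * star c)⁻¹ *
      (q ^ 2 * (star d * b) + q * (star c * b + star d * a) + star c * a)) ?_ (fun q hq => ?_) h'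
  · refine ContinuousAt.mul (ContinuousAt.inv₀ (by fun_prop) ?_) (by fun_prop)
    rw [Quaternion.coe_zero]
    simpa using hc
  · rw [Quaternion.coe_zero] at hq
    have e : ∀ r s t : ℍ[ℝ], r + q⁻¹ * s + q⁻¹ ^ 2 * t =
        (q ^ 2)⁻¹ * (q ^ 2 * r + q * s + t) := by
      intro r s t
      have : (q ^ 2)⁻¹ * q = q⁻¹ := by rw [sq, mul_inv_rev, inv_mul_cancel_right₀ hq]
      rw [inv_pow, mul_add, mul_add, inv_mul_cancel_left₀ (pow_ne_zero 2 hq), ← mul_assoc, this]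
    rw [regFrac_apply, e, e, mul_inv_rev, inv_inv, mul_assoc,
      mul_inv_cancel_left₀ (pow_ne_zero 2 hq)]

theorem regFrac_of_eq_zero {A : GL2H} (hc : A.val 0 1 = 0) (q : ℍ[ℝ]) :
    q ∈ regFracDomain A ∧
      regFrac A q = q * ((A.val 1 1)⁻¹ * A.val 0 0) + (A.val 1 1)⁻¹ * A.val 1 0 := by
  have hd := entry_ne_zero_of_eq_zero hc
  have hds : star (A.val 1 1) ≠ 0 := star_ne_zero.mpr hd
  rw [mem_regFracDomain, regFrac_apply, hc]
  simp only [zero_mul, star_zero, mul_zero, add_zero, zero_add]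
  refine ⟨mul_ne_zero hd hds, ?_⟩
  have hcomm : ∀ u : ℍ[ℝ], (A.val 1 1 * star (A.val 1 1))⁻¹ * (q * u) =
      q * ((A.val 1 1 * star (A.val 1 1))⁻¹ * u) := by
    intro u
    rw [Quaternion.self_mul_star, ← Quaternion.coe_inv, Quaternion.coe_mul_eq_smul,
      Quaternion.coe_mul_eq_smul,
      mul_smul_comm]
  have hcancel : ∀ u : ℍ[ℝ], (A.val 1 1 * star (A.val 1 1))⁻¹ * (star (A.val 1 1) * u) =
      (A.val 1 1)⁻¹ * u := by
    intro u
    rw [Quaternion.self_mul_star, ← Quaternion.star_mul_self, mul_inv_rev, mul_assoc,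
      inv_mul_cancel_left₀ hds]
  rw [mul_add, hcomm, hcancel, hcancel, add_comm]

/-- Since x and |c|² are real, hence central, the symmetrized denominator is |c|²(q - x)² and the
numerator is |c|²(q - x)(qc⁻¹a + c⁻¹b). One factor q - x cancels. -/
theorem regFrac_of_eq_neg_mul {A : GL2H} {x : ℝ} (hc : A.val 0 1 ≠ 0)
    (hd : A.val 1 1 = -((x : ℍ[ℝ]) * A.val 0 1)) {q : ℍ[ℝ]} (hq : q ≠ x) :
    q ∈ regFracDomain A ∧
      regFrac A q = (q - x)⁻¹ * (q * ((A.val 0 1)⁻¹ * A.val 0 0) + (A.val 0 1)⁻¹ * A.val 1 0) := by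
  set a := A.val 0 0
  set b := A.val 1 0
  set c := A.val 0 1
  set n := Quaternion.normSq c with hn
  have hn0 : n ≠ 0 := by rwa [hn, Ne, Quaternion.normSq_eq_zero]
  have hq' : q - x ≠ 0 := sub_ne_zero.mpr hq
  have hcc : c * star c = n • (1 : ℍ[ℝ]) := by
    rw [Quaternion.self_mul_star, ← hn, ← Quaternion.coe_mul_eq_smul, mul_one]
  have hcs : star c = n • c⁻¹ := by
    have := congrArg (c⁻¹ * ·) hcc
    simpa only [inv_mul_cancel_left₀ hc, mul_smul_comm, mul_one] using this
  have hx1 : (x : ℍ[ℝ]) = x • (1 : ℍ[ℝ]) := by rw [← Quaternion.coe_mul_eq_smul, mul_one]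
  have hden : A.val 1 1 * star (A.val 1 1) + q * (c * star (A.val 1 1) + A.val 1 1 * star c) +
      q ^ 2 * (c * star c) = n • ((q - x) * (q - x)) := by
    rw [hd, Quaternion.coe_mul_eq_smul, star_neg, Quaternion.star_smul]
    simp only [neg_mul, mul_neg, smul_mul_assoc, mul_smul_comm, hcc, mul_add, mul_one]
    rw [hx1]
    simp only [sub_mul, mul_sub, smul_mul_assoc, mul_smul_comm, one_mul, mul_one, sq]
    module
  have hnum : star (A.val 1 1) * b + q * (star c * b + star (A.val 1 1) * a) +
      q ^ 2 * (star c * a) = n • ((q - x) * (q * (c⁻¹ * a) + c⁻¹ * b)) := by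
    rw [hd, Quaternion.coe_mul_eq_smul, star_neg, Quaternion.star_smul, hcs, hx1]
    simp only [neg_mul, mul_neg, smul_mul_assoc, mul_smul_comm, mul_add, sub_mul, one_mul,
      ← mul_assoc, sq]
    module
  rw [mem_regFracDomain, regFrac_apply, hden, hnum]
  refine ⟨smul_ne_zero hn0 (mul_ne_zero hq' hq'), ?_⟩
  rw [smul_inv₀, smul_mul_smul_comm, inv_mul_cancel₀ hn0, one_smul, mul_inv_rev, mul_assoc,
    inv_mul_cancel_left₀ hq']

/-! ### Passage between real poles and explicit formulas -/

/-- The product of the matrix `A` with the scalar `u` on the left. -/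
def leftScale (u : ℍ[ℝ]ˣ) (A : GL2H) : GL2H :=
  Units.map (Matrix.scalar (Fin 2)).toMonoidHom u * A

theorem leftScale_apply (u : ℍ[ℝ]ˣ) (A : GL2H) (i j : Fin 2) :
    (leftScale u A).val i j = u * A.val i j := by
  simp [leftScale, Matrix.scalar_apply, Matrix.diagonal_mul]

/-- In general `linFrac A` differs from f, because c⁻¹ or d⁻¹ stands on the wrong side of q. Scaling
A on the left by that inverse makes the denominator q - x or 1, and then the two quotients agree. -/
theorem memLinFrac_of_isRegFracWithRealPole {Ω : Set ℍ[ℝ]} {f : ℍ[ℝ] → ℍ[ℝ]}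
    (hf : IsRegularOn Ω f) (h : IsRegFracWithRealPole Ω f) : MemLinFrac Ω f := by
  obtain ⟨A, hA, ⟨x, hx⟩ | hinf⟩ := h
  · obtain ⟨hc, hd⟩ := eq_of_hasPoleAt_regFrac hx
    set u := Units.mk0 _ (inv_ne_zero hc) with hu
    refine ⟨leftScale u A, ?_⟩
    have h01 : (leftScale u A).val 0 1 = 1 := by
      rw [leftScale_apply, hu, Units.val_mk0, inv_mul_cancel₀ hc]
    have h11 : (leftScale u A).val 1 1 = -x := by
      rw [leftScale_apply, hu, Units.val_mk0, hd, Quaternion.coe_mul_eq_smul, mul_neg,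
        mul_smul_comm,
        inv_mul_cancel₀ hc, ← Quaternion.coe_mul_eq_smul, mul_one]
    have hoff : ∀ q ∈ Ω, q ≠ x → linFrac (leftScale u A) (q : OnePoint ℍ[ℝ]) = (f q : ℍ[ℝ]) := by
      intro q hq hqx
      obtain ⟨hdom, hval⟩ := regFrac_of_eq_neg_mul hc hd hqx
      have hden : q * (leftScale u A).val 0 1 + (leftScale u A).val 1 1 = q - x := by
        rw [h01, h11, mul_one, sub_eq_add_neg]
      rw [linFrac_coe_of_ne (by rw [hden]; exact sub_ne_zero.mpr hqx), hden, hA q ⟨hq, hdom⟩, hval,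
        leftScale_apply, leftScale_apply, hu, Units.val_mk0]
    intro q hq
    -- The formula holds only off x. At x the values agree as limits, since both sides are
    -- continuous into ℍ ∪ {∞}.
    by_cases hqx : q = x
    · have t1 : Tendsto (fun q : ℍ[ℝ] => linFrac (leftScale u A) (q : OnePoint ℍ[ℝ])) (𝓝[≠] q)
          (𝓝 (linFrac (leftScale u A) (q : OnePoint ℍ[ℝ]))) :=
        (continuousAt_linFrac_coe _ q).tendsto.mono_left nhdsWithin_le_nhds
      have t2 : Tendsto (fun q : ℍ[ℝ] => ((f q : ℍ[ℝ]) : OnePoint ℍ[ℝ])) (𝓝[≠] q)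
          (𝓝 ((f q : ℍ[ℝ]) : OnePoint ℍ[ℝ])) :=
        ((OnePoint.continuous_coe.tendsto _).comp
          (hf.differentiable.continuousOn.continuousAt
            (hf.isOpen.mem_nhds hq)).tendsto).mono_left nhdsWithin_le_nhds
      refine tendsto_nhds_unique (t1.congr' ?_) t2
      filter_upwards [self_mem_nhdsWithin,
        mem_nhdsWithin_of_mem_nhds (hf.isOpen.mem_nhds hq)] with p hp hpΩ
      exact hoff p hpΩ (hqx ▸ hp)
    · exact hoff q hq hqx
  · have hc := eq_zero_of_hasPoleAtInfty_regFrac hinf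
    have hd := entry_ne_zero_of_eq_zero hc
    set u := Units.mk0 _ (inv_ne_zero hd) with hu
    refine ⟨leftScale u A, fun q hq => ?_⟩
    obtain ⟨hdom, hval⟩ := regFrac_of_eq_zero hc q
    have hden : q * (leftScale u A).val 0 1 + (leftScale u A).val 1 1 = 1 := by
      rw [leftScale_apply, leftScale_apply, hc, hu, Units.val_mk0, inv_mul_cancel₀ hd, mul_zero,
        mul_zero, zero_add]
    rw [linFrac_coe_of_ne (by rw [hden]; exact one_ne_zero), hden, hA q ⟨hq, hdom⟩, hval,
      leftScale_apply, leftScale_apply, hu, Units.val_mk0, inv_one, one_mul]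

/-- The Laurent series in every slice has only the terms of degree -1 and 0. With p = 0 this also
covers the pole of qa + b at ∞. -/
theorem hasPoleAt_of_eq_inv_mul_add {Ω : Set ℍ[ℝ]} {f : ℍ[ℝ] → ℍ[ℝ]} {p a b : ℍ[ℝ]} (ha : a ≠ 0)
    (h : ∀ q, q ≠ p → q ∈ Ω ∧ f q = (q - p)⁻¹ * a + b) : HasPoleAt Ω f p := by
  intro I _ _
  refine ⟨1, fun n => if n = -1 then a else if n = 0 then b else 0, 1,
    ⟨one_pos, fun z _ hz _ => ⟨(h z hz).1, ?_⟩⟩, fun m hm => ?_, 1, one_pos, by simpa using ha⟩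
  · rw [(h z hz).2]
    have := hasSum_sum_of_ne_finset_zero (s := {-1, 0}) (L := .unconditional ℤ)
      (f := fun n : ℤ => (z - p) ^ n * if n = -1 then a else if n = 0 then b else 0)
      (fun n hn => by
        simp only [Finset.mem_insert, Finset.mem_singleton, not_or] at hn
        simp [hn.1, hn.2])
    simpa using this
  · dsimp only
    rw [if_neg (by omega), if_neg (by omega)]

/-- The matrix of `q ↦ qa + b`. -/
def affineMatrix (a b : ℍ[ℝ]) (ha : a ≠ 0) : GL2H where
  val := !![a, 0; b, 1]
  inv := !![a⁻¹, 0; -(b * a⁻¹), 1]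
  val_inv := by
    refine Matrix.ext fun i j => ?_
    fin_cases i <;> fin_cases j <;> simp [ha]
  inv_val := by
    refine Matrix.ext fun i j => ?_
    fin_cases i <;> fin_cases j <;> simp [ha]

/-- The matrix of `q ↦ (q - x)⁻¹ a + b`. -/
def simplePoleMatrix (x : ℝ) (a b : ℍ[ℝ]) (ha : a ≠ 0) : GL2H where
  val := !![b, 1; a - x * b, -x]
  inv := !![a⁻¹ * x, a⁻¹; 1 - b * a⁻¹ * x, -(b * a⁻¹)]
  val_inv := by
    refine Matrix.ext fun i j => ?_
    fin_cases i <;> fin_cases j <;> simp [ha, sub_mul, mul_sub, mul_assoc]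
  inv_val := by
    have hx : ∀ u : ℍ[ℝ], (x : ℍ[ℝ]) * u = u * x := fun u => Quaternion.coe_commutes x u
    refine Matrix.ext fun i j => ?_
    fin_cases i <;> fin_cases j <;> simp [ha, sub_mul, mul_sub, mul_assoc, hx]

theorem isRegFracWithRealPole_of_affine {Ω : Set ℍ[ℝ]} {f : ℍ[ℝ] → ℍ[ℝ]} {a b : ℍ[ℝ]}
    (ha : a ≠ 0) (h : ∀ q ∈ Ω, f q = q * a + b) : IsRegFracWithRealPole Ω f := by
  have hval : ∀ q, q ∈ regFracDomain (affineMatrix a b ha) ∧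
      regFrac (affineMatrix a b ha) q = q * a + b := by
    intro q
    have := regFrac_of_eq_zero (A := affineMatrix a b ha) (by simp [affineMatrix]) q
    simpa [affineMatrix] using this
  refine ⟨affineMatrix a b ha, fun q hq => by rw [h q hq.1, (hval q).2], Or.inr ?_⟩
  refine hasPoleAt_of_eq_inv_mul_add ha (b := b) fun q hq => ⟨⟨hq, (hval _).1⟩, ?_⟩
  rw [(hval _).2, sub_zero]

theorem isRegFracWithRealPole_of_simplePole {Ω : Set ℍ[ℝ]} {f : ℍ[ℝ] → ℍ[ℝ]} {x : ℝ} {a b : ℍ[ℝ]}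
    (ha : a ≠ 0) (h : ∀ q ∈ Ω, q ≠ x → f q = (q - x)⁻¹ * a + b) : IsRegFracWithRealPole Ω f := by
  have hd : (simplePoleMatrix x a b ha).val 1 1 =
      -((x : ℍ[ℝ]) * (simplePoleMatrix x a b ha).val 0 1) := by simp [simplePoleMatrix]
  have hc : (simplePoleMatrix x a b ha).val 0 1 ≠ 0 := by simp [simplePoleMatrix]
  have hval : ∀ q : ℍ[ℝ], q ≠ x → q ∈ regFracDomain (simplePoleMatrix x a b ha) ∧
      regFrac (simplePoleMatrix x a b ha) q = (q - x)⁻¹ * a + b := by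
    intro q hq
    obtain ⟨h1, h2⟩ := regFrac_of_eq_neg_mul hc hd hq
    refine ⟨h1, h2.trans ?_⟩
    have e : q * b + (a - x * b) = (q - x) * b + a := by noncomm_ring
    simp only [simplePoleMatrix, Matrix.of_apply, Matrix.cons_val', Matrix.cons_val_zero,
      Matrix.cons_val_one, Matrix.cons_val_fin_one, inv_one, one_mul]
    rw [e, mul_add, inv_mul_cancel_left₀ (sub_ne_zero.mpr hq), add_comm]
  refine ⟨simplePoleMatrix x a b ha, fun q hq => ?_, Or.inl ⟨x, ?_⟩⟩
  · have hqx : q ≠ x := by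
      rintro rfl
      refine (mem_regFracDomain _ _).mp hq.2 ?_
      rw [hd]
      simp [simplePoleMatrix, sq, mul_add]
    rw [h q hq.1 hqx, (hval q hqx).2]
  · exact hasPoleAt_of_eq_inv_mul_add ha (b := b) hval

/-! ### Continuous injective extensions of semiregular functions -/

/-- The quaternion underlying a point of `ℍ ∪ {∞}`, with value `0` at `∞`. -/
def finitePart (p : OnePoint ℍ[ℝ]) : ℍ[ℝ] := p.elim 0 id

@[simp] theorem finitePart_coe (q : ℍ[ℝ]) : finitePart (q : OnePoint ℍ[ℝ]) = q := rfl

theorem coe_finitePart {p : OnePoint ℍ[ℝ]} (hp : p ≠ OnePoint.infty) :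
    ((finitePart p : ℍ[ℝ]) : OnePoint ℍ[ℝ]) = p := by
  obtain ⟨q, rfl⟩ := OnePoint.ne_infty_iff_exists.mp hp
  rfl

theorem continuousAt_finitePart {p : OnePoint ℍ[ℝ]} (hp : p ≠ OnePoint.infty) :
    ContinuousAt finitePart p := by
  obtain ⟨q, rfl⟩ := OnePoint.ne_infty_iff_exists.mp hp
  rw [ContinuousAt, OnePoint.nhds_coe_eq, tendsto_map'_iff]
  exact tendsto_id

theorem continuousAt_finitePart_comp {X : Type*} [TopologicalSpace X] {u : X → OnePoint ℍ[ℝ]}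
    {x : X} (hu : ContinuousAt u x) (hx : u x ≠ OnePoint.infty) :
    ContinuousAt (fun y => finitePart (u y)) x :=
  (continuousAt_finitePart hx).tendsto.comp hu

theorem tendsto_finitePart_infty :
    Tendsto finitePart (𝓝[≠] OnePoint.infty) (cocompact ℍ[ℝ]) := by
  rw [OnePoint.nhdsNE_infty_eq, tendsto_map'_iff, coclosedCompact_eq_cocompact]
  exact tendsto_id

theorem tendsto_finitePart_comp {X : Type*} {l : Filter X} {u : X → OnePoint ℍ[ℝ]}
    (hu : Tendsto u l (𝓝 OnePoint.infty)) (hne : ∀ᶠ x in l, u x ≠ OnePoint.infty) :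
    Tendsto (fun x => finitePart (u x)) l (cocompact ℍ[ℝ]) :=
  tendsto_finitePart_infty.comp (tendsto_nhdsWithin_iff.mpr ⟨hu, hne⟩)

/-- The finite part of a continuous extension of a semiregular function is holomorphic on each
complex line, outside the points at which the extension is infinite. -/
theorem IsSemiregular.holomorphicAt_finitePart {Ω : Set ℍ[ℝ]} {f : ℍ[ℝ] → ℍ[ℝ]}
    (hf : IsSemiregular Ω f) {φ : OnePoint ℍ[ℝ] → OnePoint ℍ[ℝ]} (hφ : Continuous φ)
    (hext : Extends Ω f φ) {I : ℍ[ℝ]} (hI : I ∈ imagUnits) {z : ℂ}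
    (hz : φ (sliceEmb I z : ℍ[ℝ]) ≠ OnePoint.infty) :
    HolomorphicAt I (fun w => finitePart (φ (sliceEmb I w : ℍ[ℝ]))) z := by
  have hΩ : ∀ w, sliceEmb I w ∈ Ω →
      HolomorphicAt I (fun w => finitePart (φ (sliceEmb I w : ℍ[ℝ]))) w := by
    intro w hw
    refine (hf.isRegularOn.holomorphicAt hI hw).congr ?_
    filter_upwards [(continuous_sliceEmb I).continuousAt.eventually
      (hf.isRegularOn.isOpen.mem_nhds hw)] with v hv
    rw [hext _ hv, finitePart_coe]
  by_cases hzΩ : sliceEmb I z ∈ Ω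
  · exact hΩ z hzΩ
  -- Outside Ω, the Laurent expansion supplies a punctured disc of L_I inside Ω, and continuity of φ
  -- removes the singularity.
  · refine holomorphicAt_of_punctured ?_ ?_
    · obtain ⟨R, a, N, ⟨hR, hL⟩, -⟩ :=
        hf.nonessential _ hzΩ I hI (mem_slice_iff.mpr ⟨z, rfl⟩)
      filter_upwards [self_mem_nhdsWithin,
        mem_nhdsWithin_of_mem_nhds (Metric.ball_mem_nhds z hR)] with w hw hwR
      refine hΩ w (hL _ (mem_slice_iff.mpr ⟨w, rfl⟩) ?_ ?_).1
      · exact fun h => hw (sliceEmb_injective hI h)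
      · rw [← sliceEmb_sub, norm_sliceEmb hI, ← dist_eq_norm]
        exact hwR
    · exact continuousAt_finitePart_comp
        (hφ.comp (OnePoint.continuous_coe.comp (continuous_sliceEmb I))).continuousAt hz

theorem isRegFracWithRealPole_of_infty {Ω : Set ℍ[ℝ]} {f : ℍ[ℝ] → ℍ[ℝ]}
    (hf : IsSemiregular Ω f) {φ : OnePoint ℍ[ℝ] → OnePoint ℍ[ℝ]} (hφ : Continuous φ)
    (hinj : Function.Injective φ) (hext : Extends Ω f φ)
    (hinf : φ OnePoint.infty = OnePoint.infty) : IsRegFracWithRealPole Ω f := by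
  have hne : ∀ q : ℍ[ℝ], φ q ≠ OnePoint.infty := fun q h =>
    OnePoint.coe_ne_infty q (hinj (h.trans hinf.symm))
  have hlim : Tendsto (fun q : ℍ[ℝ] => φ q) (cocompact ℍ[ℝ]) (𝓝 OnePoint.infty) := by
    have := (hφ.tendsto OnePoint.infty).comp (OnePoint.tendsto_coe_infty (X := ℍ[ℝ]))
    rwa [hinf, coclosedCompact_eq_cocompact] at this
  obtain ⟨a, b, ha, hab⟩ := exists_affine_of_injective (g := fun q : ℍ[ℝ] => finitePart (φ q))
    (fun p q h => by
      have := congrArg ((↑) : ℍ[ℝ] → OnePoint ℍ[ℝ]) h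
      dsimp only at this
      rw [coe_finitePart (hne p), coe_finitePart (hne q)] at this
      exact OnePoint.coe_injective (hinj this))
    (fun I hI z => hf.holomorphicAt_finitePart hφ hext hI (hne _))
    (tendsto_finitePart_comp hlim (Eventually.of_forall hne))
  refine isRegFracWithRealPole_of_affine ha (b := b) fun q hq => ?_
  rw [← hab, hext q hq, finitePart_coe]

/-- The map ι(q) = x + q⁻¹ carries the point x to ∞. Since x is real, ι respects every slice, so the
finite part of φ ∘ ι is an injective entire slice function tending to ∞, hence affine. -/
theorem isRegFracWithRealPole_of_real {Ω : Set ℍ[ℝ]} {f : ℍ[ℝ] → ℍ[ℝ]}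
    (hf : IsSemiregular Ω f) {φ : OnePoint ℍ[ℝ] → OnePoint ℍ[ℝ]} (hφ : Continuous φ)
    (hinj : Function.Injective φ) (hext : Extends Ω f φ) {x : ℝ}
    (hx : φ ((x : ℍ[ℝ]) : OnePoint ℍ[ℝ]) = OnePoint.infty) : IsRegFracWithRealPole Ω f := by
  classical
  let ι : ℍ[ℝ] → OnePoint ℍ[ℝ] := fun q =>
    if q = 0 then OnePoint.infty else (((x : ℍ[ℝ]) + q⁻¹ : ℍ[ℝ]) : OnePoint ℍ[ℝ])
  have ι_zero : ι 0 = OnePoint.infty := if_pos rfl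
  have ι_ne : ∀ q, q ≠ 0 → ι q = (((x : ℍ[ℝ]) + q⁻¹ : ℍ[ℝ]) : OnePoint ℍ[ℝ]) := fun q hq =>
    if_neg hq
  have ι_inj : Function.Injective ι := by
    intro p q h
    by_cases hp : p = 0 <;> by_cases hq : q = 0
    · rw [hp, hq]
    · rw [hp, ι_zero, ι_ne q hq] at h
      exact absurd h (OnePoint.infty_ne_coe _)
    · rw [hq, ι_zero, ι_ne p hp] at h
      exact absurd h (OnePoint.coe_ne_infty _)
    · rw [ι_ne p hp, ι_ne q hq, OnePoint.coe_eq_coe] at h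
      exact inv_injective (add_left_cancel h)
  have ι_x : ∀ q, ι q ≠ ((x : ℍ[ℝ]) : OnePoint ℍ[ℝ]) := by
    intro q h
    by_cases hq : q = 0
    · rw [hq, ι_zero] at h
      exact OnePoint.infty_ne_coe _ h
    · rw [ι_ne q hq, OnePoint.coe_eq_coe, add_eq_left] at h
      exact inv_ne_zero hq h
  have hne : ∀ q, φ (ι q) ≠ OnePoint.infty := fun q h => ι_x q (hinj (h.trans hx.symm))
  have ι_cont : ContinuousAt ι 0 := by
    rw [continuousAt_iff_punctured_nhds, ι_zero]
    have h1 : Tendsto (fun q : ℍ[ℝ] => (x : ℍ[ℝ]) + q⁻¹) (𝓝[≠] 0) (coclosedCompact ℍ[ℝ]) := by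
      have hshift : Tendsto (fun q : ℍ[ℝ] => (x : ℍ[ℝ]) + q) (cocompact ℍ[ℝ]) (cocompact ℍ[ℝ]) :=
        (Homeomorph.addLeft (x : ℍ[ℝ])).isClosedEmbedding.tendsto_cocompact
      rw [coclosedCompact_eq_cocompact]
      rw [← Metric.cobounded_eq_cocompact] at hshift ⊢
      exact hshift.comp Filter.tendsto_inv₀_nhdsNE_zero
    refine (OnePoint.tendsto_coe_infty.comp h1).congr' ?_
    filter_upwards [self_mem_nhdsWithin] with q hq
    exact (ι_ne q hq).symm
  have hlim : Tendsto (fun q => φ (ι q)) (cocompact ℍ[ℝ]) (𝓝 OnePoint.infty) := by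
    have hinv : Tendsto (fun q : ℍ[ℝ] => (x : ℍ[ℝ]) + q⁻¹) (cocompact ℍ[ℝ]) (𝓝 (x : ℍ[ℝ])) := by
      rw [← Metric.cobounded_eq_cocompact]
      simpa using (Filter.tendsto_inv₀_cobounded (α := ℍ[ℝ])).const_add (x : ℍ[ℝ])
    rw [← hx]
    refine (hφ.tendsto _).comp (((OnePoint.continuous_coe.tendsto _).comp hinv).congr' ?_)
    have h0 : ∀ᶠ q in cocompact ℍ[ℝ], q ≠ 0 := isCompact_singleton.compl_mem_cocompact
    filter_upwards [h0] with q hq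
    exact (ι_ne q hq).symm
  have hhol : ∀ I ∈ imagUnits, ∀ z,
      HolomorphicAt I (fun w => finitePart (φ (ι (sliceEmb I w)))) z := by
    intro I hI
    have hemb : ∀ w : ℂ, w ≠ 0 → sliceEmb I w ≠ 0 := fun w hw h => by
      rw [← norm_eq_zero, norm_sliceEmb hI, norm_eq_zero] at h
      exact hw h
    have hι : ∀ w : ℂ, w ≠ 0 →
        ι (sliceEmb I w) = ((sliceEmb I ((x : ℂ) + w⁻¹) : ℍ[ℝ]) : OnePoint ℍ[ℝ]) := by
      intro w hw
      rw [ι_ne _ (hemb w hw), sliceEmb_add, sliceEmb_ofReal, sliceEmb_inv hI]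
    have hoff : ∀ w : ℂ, w ≠ 0 →
        HolomorphicAt I (fun w => finitePart (φ (ι (sliceEmb I w)))) w := by
      intro w hw
      have h1 : HolomorphicAt I (fun v => finitePart (φ (sliceEmb I v : ℍ[ℝ]))) ((x : ℂ) + w⁻¹) :=
        hf.holomorphicAt_finitePart hφ hext hI (by rw [← hι w hw]; exact hne _)
      refine (h1.comp (h := fun w => (x : ℂ) + w⁻¹)
        ((differentiableAt_inv hw).const_add _)).congr ?_
      filter_upwards [isOpen_ne.mem_nhds hw] with v hv
      rw [hι v hv]
    intro z
    by_cases hz : z = 0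
    · subst hz
      have h0 : sliceEmb I 0 = 0 := by simp [sliceEmb]
      -- At w = 0 the value is φ(∞), which is finite by injectivity, so the singularity is removable
      -- by continuity.
      refine holomorphicAt_of_punctured ?_ ?_
      · filter_upwards [self_mem_nhdsWithin] with w hw using hoff w hw
      · have c1 : ContinuousAt (fun w => ι (sliceEmb I w)) 0 :=
          ContinuousAt.comp (g := ι) (by rw [h0]; exact ι_cont)
            (continuous_sliceEmb I).continuousAt
        exact continuousAt_finitePart_comp ((hφ.tendsto _).comp c1) (hne _)
    · exact hoff z hz
  obtain ⟨a, b, ha, hab⟩ := exists_affine_of_injective (g := fun q => finitePart (φ (ι q)))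
    (fun p q h => by
      have := congrArg ((↑) : ℍ[ℝ] → OnePoint ℍ[ℝ]) h
      dsimp only at this
      rw [coe_finitePart (hne p), coe_finitePart (hne q)] at this
      exact ι_inj (hinj this))
    hhol (tendsto_finitePart_comp hlim (Eventually.of_forall hne))
  refine isRegFracWithRealPole_of_simplePole (x := x) ha (b := b) fun q hq hqx => ?_
  rw [← hab, ι_ne _ (inv_ne_zero (sub_ne_zero.mpr hqx)), inv_inv, add_sub_cancel, hext q hq,
    finitePart_coe]

/-- A continuous extension of a semiregular function that is infinite at one point only, cannot be
infinite at a nonreal point. -/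
theorem im_eq_zero_of_eq_infty {Ω : Set ℍ[ℝ]} {f : ℍ[ℝ] → ℍ[ℝ]}
    (hf : IsSemiregular Ω f) {φ : OnePoint ℍ[ℝ] → OnePoint ℍ[ℝ]} (hφ : Continuous φ)
    (hinj : Function.Injective φ) (hext : Extends Ω f φ) {I : ℍ[ℝ]} (hI : I ∈ imagUnits) {z₀ : ℂ}
    (hz₀ : φ (sliceEmb I z₀ : ℍ[ℝ]) = OnePoint.infty) : z₀.im = 0 := by
  by_contra him
  -- For J ≠ ±I the slices L_I and L_J meet only in ℝ, so L_J avoids the nonreal point where φ is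
  -- infinite.
  obtain ⟨J, hJ, hJI, hJI'⟩ : ∃ J ∈ imagUnits, J ≠ I ∧ J ≠ -I := by
    have hij : unitI ≠ unitJ ∧ unitI ≠ -unitJ := by
      constructor <;> intro h <;> simpa using congrArg QuaternionAlgebra.imI h
    by_cases h : unitI ≠ I ∧ unitI ≠ -I
    · exact ⟨unitI, unitI_mem, h⟩
    · refine ⟨unitJ, unitJ_mem, ?_, ?_⟩
      · rintro rfl
        exact h hij
      · rintro h'
        refine h ⟨fun h1 => hij.2 ?_, fun h1 => hij.1 ?_⟩
        · rw [h', h1, neg_neg]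
        · rw [h', h1]
  have hne_of : ∀ K ∈ imagUnits, ∀ z, sliceEmb K z ≠ sliceEmb I z₀ →
      φ (sliceEmb K z : ℍ[ℝ]) ≠ OnePoint.infty := fun K _ z h h' =>
    h (OnePoint.coe_injective (hinj (h'.trans hz₀.symm)))
  have hJne : ∀ K ∈ imagUnits, K ≠ I → K ≠ -I → ∀ z, sliceEmb K z ≠ sliceEmb I z₀ := by
    intro K hK h1 h2 z h
    rw [sliceEmb_eq, sliceEmb_eq] at h
    have hre : z.re = z₀.re := by
      have := congrArg QuaternionAlgebra.re h
      simpa [re_imagUnit hK, re_imagUnit hI] using this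
    rw [hre] at h
    have h3 := add_left_cancel h
    have h4 : |z.im| = |z₀.im| := by
      have := congrArg norm h3
      rwa [norm_smul, norm_smul, norm_imagUnit hK, norm_imagUnit hI, mul_one, mul_one] at this
    rcases abs_eq_abs.mp h4 with h5 | h5
    · rw [h5] at h3
      exact h1 (smul_right_injective _ him h3)
    · rw [h5, neg_smul, ← smul_neg] at h3
      exact h2 (neg_eq_iff_eq_neg.mp (smul_right_injective _ him h3))
  have hJ' := neg_mem_imagUnits hJ
  have hneJ : ∀ z, φ (sliceEmb J z : ℍ[ℝ]) ≠ OnePoint.infty := fun z =>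
    hne_of J hJ z (hJne J hJ hJI hJI' z)
  have hneJ' : ∀ z, φ (sliceEmb (-J) z : ℍ[ℝ]) ≠ OnePoint.infty := fun z =>
    hne_of _ hJ' z (hJne _ hJ' (fun h => hJI' (neg_eq_iff_eq_neg.mp h))
      (fun h => hJI (neg_injective h)) z)
  have hneI : ∀ z, z ≠ z₀ → φ (sliceEmb I z : ℍ[ℝ]) ≠ OnePoint.infty := fun z hz =>
    hne_of I hI z fun h => hz (sliceEmb_injective hI h)
  -- The plane minus z₀ is still connected, and it contains the real point 0 because z₀ is not real.
  -- Hence the representation formula holds on all of it.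
  have hconn : IsPreconnected ({z₀}ᶜ : Set ℂ) :=
    (isConnected_compl_singleton_of_one_lt_rank (by rw [Complex.rank_real_complex]; norm_num)
      z₀).isPreconnected
  have hrep : ∀ z, z ≠ z₀ → finitePart (φ (sliceEmb I z : ℍ[ℝ])) =
      ((1 / 2 : ℝ) • (1 - I * J)) * finitePart (φ (sliceEmb J z : ℍ[ℝ])) +
      ((1 / 2 : ℝ) • (1 + I * J)) * finitePart (φ (sliceEmb (-J) z : ℍ[ℝ])) := by
    intro z hz
    refine representation (F := fun q => finitePart (φ (q : OnePoint ℍ[ℝ]))) hI hJ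
      isOpen_compl_singleton hconn (t₀ := 0) (fun h => him ?_)
      (fun w hw => hf.holomorphicAt_finitePart hφ hext hI (hneI w hw))
      (fun w _ => hf.holomorphicAt_finitePart hφ hext hJ (hneJ w))
      (fun w _ => hf.holomorphicAt_finitePart hφ hext hJ' (hneJ' w)) hz
    rw [← Set.mem_singleton_iff.mp h, Complex.ofReal_im]
  have hcont : ∀ K, (∀ z, φ (sliceEmb K z : ℍ[ℝ]) ≠ OnePoint.infty) →
      Tendsto (fun z => finitePart (φ (sliceEmb K z : ℍ[ℝ]))) (𝓝[≠] z₀)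
        (𝓝 (finitePart (φ (sliceEmb K z₀ : ℍ[ℝ])))) := fun K hK =>
    (continuousAt_finitePart_comp
      (hφ.comp (OnePoint.continuous_coe.comp (continuous_sliceEmb K))).continuousAt
      (hK z₀)).tendsto.mono_left nhdsWithin_le_nhds
  -- The right side of `hrep` has a finite limit at z₀, while the left side leaves every compact
  -- set.
  have hlim := ((hcont J hneJ).const_mul ((1 / 2 : ℝ) • (1 - I * J))).add
    ((hcont (-J) hneJ').const_mul ((1 / 2 : ℝ) • (1 + I * J)))
  have hblow : Tendsto (fun z => finitePart (φ (sliceEmb I z : ℍ[ℝ]))) (𝓝[≠] z₀)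
      (cocompact ℍ[ℝ]) := by
    refine tendsto_finitePart_comp ?_ ?_
    · rw [← hz₀]
      exact ((hφ.comp (OnePoint.continuous_coe.comp (continuous_sliceEmb I))).tendsto
        z₀).mono_left nhdsWithin_le_nhds
    · filter_upwards [self_mem_nhdsWithin] with z hz using hneI z hz
  refine (hblow.congr' ?_).not_tendsto (disjoint_nhds_cocompact _).symm hlim
  filter_upwards [self_mem_nhdsWithin] with z hz using hrep z hz

theorem isRegFracWithRealPole_of_extends {Ω : Set ℍ[ℝ]} {f : ℍ[ℝ] → ℍ[ℝ]}
    (hf : IsSemiregular Ω f) {φ : OnePoint ℍ[ℝ] → OnePoint ℍ[ℝ]} (hφ : Continuous φ)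
    (hinj : Function.Injective φ) (hext : Extends Ω f φ) : IsRegFracWithRealPole Ω f := by
  by_cases hinf : φ OnePoint.infty = OnePoint.infty
  · exact isRegFracWithRealPole_of_infty hf hφ hinj hext hinf
  by_cases hp : ∃ p : ℍ[ℝ], φ p = OnePoint.infty
  · obtain ⟨p, hp⟩ := hp
    obtain ⟨I, hI, z₀, rfl⟩ := exists_sliceEmb p
    have him := im_eq_zero_of_eq_infty hf hφ hinj hext hI hp
    have hz₀ : sliceEmb I z₀ = (z₀.re : ℍ[ℝ]) := by simp [sliceEmb, him]
    rw [hz₀] at hp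
    exact isRegFracWithRealPole_of_real hf hφ hinj hext hp
  · push Not at hp
    -- If φ is finite everywhere, its restriction to L_i is entire with a finite limit at ∞. It is
    -- then constant, against injectivity.
    exfalso
    have hlim : Tendsto (fun z => finitePart (φ (sliceEmb unitI z : ℍ[ℝ]))) (cocompact ℂ)
        (𝓝 (finitePart (φ OnePoint.infty))) := by
      have h1 : Tendsto (sliceEmb unitI) (cocompact ℂ) (cocompact ℍ[ℝ]) := by
        rw [← Metric.cobounded_eq_cocompact, ← Metric.cobounded_eq_cocompact,
          ← tendsto_norm_atTop_iff_cobounded]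
        simp only [norm_sliceEmb unitI_mem]
        exact tendsto_norm_cobounded_atTop
      rw [← coclosedCompact_eq_cocompact (X := ℍ[ℝ])] at h1
      exact (continuousAt_finitePart hinf).tendsto.comp
        ((hφ.tendsto _).comp (OnePoint.tendsto_coe_infty.comp h1))
    have hconst := eq_of_tendsto_cocompact
      (fun z => hf.holomorphicAt_finitePart hφ hext unitI_mem (hp _)) hlim
    have h01 : φ (sliceEmb unitI 0 : ℍ[ℝ]) = φ (sliceEmb unitI 1 : ℍ[ℝ]) := by
      rw [← coe_finitePart (hp (sliceEmb unitI 0)), ← coe_finitePart (hp (sliceEmb unitI 1)),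
        hconst 0, hconst 1]
    exact zero_ne_one (sliceEmb_injective unitI_mem (OnePoint.coe_injective (hinj h01)))

end

end SliceRegular

theorem corollary6p4 (Ω : Set ℍ[ℝ]) (f : ℍ[ℝ] → ℍ[ℝ])
    (hf : SliceRegular.IsSemiregular Ω f) :
    List.TFAE [
      ∃ φ : OnePoint ℍ[ℝ] ≃ₜ OnePoint ℍ[ℝ], SliceRegular.Extends Ω f φ,
      ∃ φ : OnePoint ℍ[ℝ] → OnePoint ℍ[ℝ],
        Continuous φ ∧ Function.Injective φ ∧ SliceRegular.Extends Ω f φ,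
      SliceRegular.IsRegFracWithRealPole Ω f,
      SliceRegular.MemRegFrac Ω f ∧ SliceRegular.MemLinFrac Ω f] := by
  tfae_have 1 → 2 := fun ⟨φ, hφ⟩ => ⟨φ, φ.continuous, φ.injective, hφ⟩
  tfae_have 2 → 3 := fun ⟨_, hφ, hinj, hext⟩ =>
    SliceRegular.isRegFracWithRealPole_of_extends hf hφ hinj hext
  tfae_have 3 → 4 := fun h =>
    ⟨⟨h.choose, h.choose_spec.1⟩,
      SliceRegular.memLinFrac_of_isRegFracWithRealPole hf.isRegularOn h⟩
  tfae_have 4 → 1 := fun ⟨_, A, hA⟩ => ⟨SliceRegular.linFracHomeomorph A, hA⟩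
  tfae_finish
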